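/- **Skew Cauchy identity.** Let $a=(a_k)_{k\in\mathbb Z}$, $b=(b_k)_{k\in\mathbb Z}$ be two sequences of parameters, let $a'_k=-a_{1-k}$, $b'_k=-b_{1-k}$, and put $(t;a)^k=\prod_{i=1}^k(1-a_it)$. For a partition $\lambda$, let $|\lambda\rangle$ be its Maya diagram, in which the column $k\in\mathbb Z$ is occupied iff $k=\lambda_i-i+1$ for some $i\ge1$. Let $\mathcal A_{a,b}(x,y)$ be the row transfer operator of the six vertex model with paths going down and right, with weights $\mathsf a_1=1-bx$, $\mathsf a_2=y+a$, $\mathsf b_1=1+by$, $\mathsf b_2=x-a$, $\mathsf c_1=1-ab$, $\mathsf c_2=x+y$ (in order: empty vertex; all edges occupied; only vertical edges occupied; only horizontal edges occupied; path from top to right; path from left to bottom). That is, $\langle\mu|\mathcal A_{a,b}(x,y)|\lambda\rangle$ is the stable value, for large $n,m$, of the partition function of the row with columns $-n+1,\dots,m$ (column $k$ with parameters $a_k,b_k$), top edges given by $\mu$, bottom edges by $\lambda$, and unoccupied left and right boundary edges, divided by $(y;b')^n(x;b)^m$. Let $\widehat{\mathcal A}_{a,b}(x,y)$ be the operator defined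 in the same way with paths going down and left, with weights $\widehat{\mathsf a}_1=1-ax$, $\widehat{\mathsf a}_2=y+b$, $\widehat{\mathsf b}_1=1+ay$, $\widehat{\mathsf b}_2=x-b$, $\widehat{\mathsf d}_1=1-ab$ (path from top to left), $\widehat{\mathsf d}_2=x+y$ (path from right to bottom), and divisor $(y;a')^n(x;a)^m$. For $x=(x_1,\dots,x_n)$, $y=(y_1,\dots,y_n)$ define $$s_{\lambda/\mu;a,b}(x/y)=\langle\mu|\mathcal A_{a,b}(x_1,y_1)\cdots\mathcal A_{a,b}(x_n,y_n)|\lambda\rangle,\qquad \widehat s_{\lambda/\mu;a,b}(x/y)=\langle\lambda|\widehat{\mathcal A}_{a,b}(x_1,y_1)\cdots\widehat{\mathcal A}_{a,b}(x_n,y_n)|\mu\rangle .$$ Let $\mu,\nu$ be partitions. For all $n,m\ge 0$, $x=(x_1,\dots,x_n)$, $y=(y_1,\dots,y_n)$, $z=(z_1,\dots,z_m)$, $w=(w_1,\dots,w_m)$, $$\sum_{\lambda}s_{\lambda/\mu;a,b}(x/y)\,\widehat s_{\lambda/\nu;a,b}(z/w)=\prod_{i=1}^{n}\prod_{j=1}^{m}\frac{1+y_iz_j}{1-x_iz_j}\,\frac{1+x_iw_j}{1-y_iw_j}\;\sum_{\rho}\widehat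 s_{\mu/\rho;a,b}(z/w)\,s_{\nu/\rho;a,b}(x/y),$$ in both of the following algebraic senses (the sum over $\rho$ is always finite). 1. All $x_i,y_i,z_j,w_j,a_k,b_k$ are independent indeterminates, and the identity holds in the ring of formal power series over $\mathbb Z$ in all of them; the sum over $\lambda$ converges coefficientwise. 2. There is an integer $K$, depending only on $\mu$ and $\nu$, such that for all $n,m$ and all values of $x,y,z,w,a,b$ in a field for which the denominators $1-b_kx_i$, $1-a_kz_j$ ($k\ge1$), $1+b_ky_i$, $1+a_kw_j$ ($k\le0$), $1-x_iz_j$, $1-y_iw_j$ are nonzero, the sum over $\lambda$ has only finitely many nonzero terms and the identity holds, provided that - either there are distinct integers $l_1,\dots,l_n\ge K$ with $x_i=a_{l_i}$ for all $i$, or distinct integers $l_1,\dots,l_m\ge K$ with $z_j=b_{l_j}$ for all $j$; and - either there are distinct integers $k_1,\dots,k_n\ge K$ with $y_i=a'_{k_i}$ for all $i$, or distinct integers $k_1,\dots,k_m\ge K$ with $w_j=b'_{k_j}$ for all $j$. -/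

import Mathlib

open scoped MvPowerSeries.WithPiTopology

noncomputable section

namespace FreeFermionic

variable {R : Type*} [CommRing R]

/-- The dual sequence `a'`, with `a'_i = -a_{-i+1}`. -/
def dualSeq (a : ℤ → R) : ℤ → R := fun i => -a (-i + 1)

/-- The shifted power `(x;a)^k = (1 - a_1 x)(1 - a_2 x) ... (1 - a_k x)`, for `k ≥ 0`. -/
def shiftedPow (x : R) (a : ℤ → R) (k : ℕ) : R :=
  ∏ i ∈ Finset.range k, (1 - a ((i : ℤ) + 1) * x)

/-! ### Vertices

Horizontal edges are labelled by `Fin 2` (`0` unoccupied, `1` occupied), vertical edges by `Bool`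
(`true` occupied). A vertex whose top and bottom edges are fixed is a `2 × 2` matrix whose entry
`(l, r)` is the weight of the vertex with left edge `l` and right edge `r`. -/

/-- The standard vertex (paths go down and right), with the weights
`a₁ = 1 - bx`, `a₂ = y + a`, `b₁ = 1 + by`, `b₂ = x - a`, `c₁ = 1 - ab`, `c₂ = x + y`. -/
def vertex (x y a b : R) : (top bottom : Bool) → Matrix (Fin 2) (Fin 2) R
  | false, false => !![1 - b * x, 0; 0, x - a]
  | true, true => !![1 + b * y, 0; 0, y + a]
  | true, false => !![0, 1 - a * b; 0, 0]
  | false, true => !![0, 0; x + y, 0]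

/-- The dual vertex (paths go down and left), with the weights
`â₁ = 1 - ax`, `â₂ = y + b`, `b̂₁ = 1 + ay`, `b̂₂ = x - b`, `d̂₁ = 1 - ab`, `d̂₂ = x + y`. -/
def dualVertex (x y a b : R) : (top bottom : Bool) → Matrix (Fin 2) (Fin 2) R
  | false, false => !![1 - a * x, 0; 0, x - b]
  | true, true => !![1 + a * y, 0; 0, y + b]
  | true, false => !![0, 0; 1 - a * b, 0]
  | false, true => !![0, x + y; 0, 0]

/-- The row with the `N` columns `k, k+1, ..., k+N-1`, as a matrix in the left and right boundary
edges: the entry `(l, r)` is the sum over all states of the internal edges of the product of the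
vertex weights. -/
def rowProd (M : ℤ → Matrix (Fin 2) (Fin 2) R) : ℤ → ℕ → Matrix (Fin 2) (Fin 2) R
  | _, 0 => 1
  | k, N + 1 => M k * rowProd M (k + 1) N

/-! ### Maya diagrams and the infinite row transfer operators -/

open Classical in
/-- The Maya diagram of level zero of a partition `λ`: the column `k` is occupied iff
`k = λ_i - i + 1` for some `i ≥ 1` (the rows of a `YoungDiagram` are numbered from `0`). -/
def occ (lam : YoungDiagram) (k : ℤ) : Bool :=
  decide (∃ i : ℕ, k = (lam.rowLen i : ℤ) - i)

/-- `⟨μ| A(x,y; a^{n,m}, b^{n,m}) |λ⟩`: the columns are `-n+1, ..., m`, the top edges are given by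
`μ`, the bottom edges by `λ`, and the left and right boundary edges are unoccupied. -/
def finA (a b : ℤ → R) (x y : R) (mu lam : YoungDiagram) (n m : ℕ) : R :=
  rowProd (fun k => vertex x y (a k) (b k) (occ mu k) (occ lam k)) (-(n : ℤ) + 1) (n + m) 0 0

/-- `⟨λ| Â(x,y; a^{n,m}, b^{n,m}) |μ⟩`, with top edges given by `λ` and bottom edges by `μ`. -/
def finAhat (a b : ℤ → R) (x y : R) (lam mu : YoungDiagram) (n m : ℕ) : R :=
  rowProd (fun k => dualVertex x y (a k) (b k) (occ lam k) (occ mu k)) (-(n : ℤ) + 1) (n + m) 0 0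

/-- Outside the columns `-N+1, ..., N` for this `N`, the Maya diagrams of `λ` and `μ` are both
occupied on the left and both unoccupied on the right. -/
def cutoff (lam mu : YoungDiagram) : ℕ :=
  max (max (lam.rowLen 0) (lam.colLen 0)) (max (mu.rowLen 0) (mu.colLen 0))

/-- The normalized coefficient
`⟨μ| A(x,y; a^{n,m}, b^{n,m}) |λ⟩ / ((y;b')^n (x;b)^m)`. -/
def normA (a b : ℤ → R) (x y : R) (mu lam : YoungDiagram) (n m : ℕ) : R :=
  finA a b x y mu lam n m * Ring.inverse (shiftedPow y (dualSeq b) n * shiftedPow x b m)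

/-- The normalized coefficient
`⟨λ| Â(x,y; a^{n,m}, b^{n,m}) |μ⟩ / ((y;a')^n (x;a)^m)`. -/
def normAhat (a b : ℤ → R) (x y : R) (lam mu : YoungDiagram) (n m : ℕ) : R :=
  finAhat a b x y lam mu n m * Ring.inverse (shiftedPow y (dualSeq a) n * shiftedPow x a m)

/-- The matrix coefficient `⟨μ| 𝒜_{a,b}(x,y) |λ⟩` of the infinite row transfer operator, that is,
the stable value of `normA` for large `n`, `m` (see `normA_eq_opA`). -/
def opA (a b : ℤ → R) (x y : R) (mu lam : YoungDiagram) : R :=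
  normA a b x y mu lam (cutoff mu lam) (cutoff mu lam)

/-- The matrix coefficient `⟨λ| 𝒜̂_{a,b}(x,y) |μ⟩` of the dual infinite row transfer operator, that
is, the stable value of `normAhat` for large `n`, `m` (see `normAhat_eq_opAhat`). -/
def opAhat (a b : ℤ → R) (x y : R) (lam mu : YoungDiagram) : R :=
  normAhat a b x y lam mu (cutoff lam mu) (cutoff lam mu)

/-- The matrix coefficient `⟨μ| T_1 T_2 ... T_n |λ⟩` of a composition of operators that are given
by their matrix coefficients (the sum runs over the intermediate basis vector). -/
def compCoeff : {n : ℕ} → (Fin n → YoungDiagram → YoungDiagram → R) →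
    YoungDiagram → YoungDiagram → R
  | 0, _, mu, lam => open Classical in if mu = lam then 1 else 0
  | _ + 1, T, mu, lam => ∑ᶠ kap : YoungDiagram, T 0 mu kap * compCoeff (fun i => T i.succ) kap lam

/-- The free fermionic Schur function
`s_{λ/μ;a,b}(x/y) = ⟨μ| 𝒜_{a,b}(x_1,y_1) ... 𝒜_{a,b}(x_n,y_n) |λ⟩`. -/
def schur {n : ℕ} (a b : ℤ → R) (x y : Fin n → R) (lam mu : YoungDiagram) : R :=
  compCoeff (fun i => opA a b (x i) (y i)) mu lam

/-- The dual free fermionic Schur function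
`ŝ_{λ/μ;a,b}(x/y) = ⟨λ| 𝒜̂_{a,b}(x_1,y_1) ... 𝒜̂_{a,b}(x_n,y_n) |μ⟩`. -/
def dualSchur {n : ℕ} (a b : ℤ → R) (x y : Fin n → R) (lam mu : YoungDiagram) : R :=
  compCoeff (fun i => opAhat a b (x i) (y i)) lam mu

/-- The factor `∏_{i,j} (1 + y_i z_j)/(1 - x_i z_j) · (1 + x_i w_j)/(1 - y_i w_j)`. -/
def cauchyFactor {n m : ℕ} (x y : Fin n → R) (z w : Fin m → R) : R :=
  ∏ i, ∏ j, ((1 + y i * z j) * Ring.inverse (1 - x i * z j)) *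
    ((1 + x i * w j) * Ring.inverse (1 - y i * w j))

/-! ### The ring of formal power series in all indeterminates -/

/-- The indeterminates `x_1, ..., x_n`, `y_1, ..., y_n`, `z_1, ..., z_m`, `w_1, ..., w_m`,
`(a_k)_{k ∈ ℤ}`, `(b_k)_{k ∈ ℤ}`. -/
inductive Var (n m : ℕ) : Type
  | x (i : Fin n)
  | y (i : Fin n)
  | z (j : Fin m)
  | w (j : Fin m)
  | a (k : ℤ)
  | b (k : ℤ)

/-- Formal power series over `ℤ` in all the indeterminates. -/
abbrev PS (n m : ℕ) : Type := MvPowerSeries (Var n m) ℤ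

/-- The indeterminates `x_i`. -/
def PS.x (n m : ℕ) : Fin n → PS n m := fun i => MvPowerSeries.X (Var.x i)

/-- The indeterminates `y_i`. -/
def PS.y (n m : ℕ) : Fin n → PS n m := fun i => MvPowerSeries.X (Var.y i)

/-- The indeterminates `z_i`. -/
def PS.z (n m : ℕ) : Fin m → PS n m := fun i => MvPowerSeries.X (Var.z i)

/-- The indeterminates `w_i`. -/
def PS.w (n m : ℕ) : Fin m → PS n m := fun i => MvPowerSeries.X (Var.w i)

/-- The indeterminates `a_i`. -/
def PS.a (n m : ℕ) : ℤ → PS n m := fun i => MvPowerSeries.X (Var.a i)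

/-- The indeterminates `b_i`. -/
def PS.b (n m : ℕ) : ℤ → PS n m := fun i => MvPowerSeries.X (Var.b i)

/-! ### The coefficients stabilize -/

theorem occ_right {lam : YoungDiagram} {k : ℤ} (h : (lam.rowLen 0 : ℤ) < k) :
    occ lam k = false := by
  simp only [occ, decide_eq_false_iff_not, not_exists]
  intro i hi
  have := lam.rowLen_anti 0 i (Nat.zero_le _)
  omega

theorem occ_left {lam : YoungDiagram} {k : ℤ} (h : k ≤ -(lam.colLen 0 : ℤ)) :
    occ lam k = true := by
  simp only [occ, decide_eq_true_eq]
  refine ⟨k.natAbs, ?_⟩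
  have h0 : lam.rowLen k.natAbs = 0 := by
    by_contra hne
    have h1 : (k.natAbs, 0) ∈ lam := YoungDiagram.mem_iff_lt_rowLen.2 (Nat.pos_of_ne_zero hne)
    have h2 := YoungDiagram.mem_iff_lt_colLen.1 h1
    omega
  rw [h0]
  omega

theorem rowProd_add (M : ℤ → Matrix (Fin 2) (Fin 2) R) (k : ℤ) (N N' : ℕ) :
    rowProd M k (N + N') = rowProd M k N * rowProd M (k + N) N' := by
  induction N generalizing k with
  | zero => simp [rowProd]
  | succ N ih =>
    rw [Nat.add_right_comm, rowProd, rowProd, ih, Matrix.mul_assoc]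
    push_cast
    rw [add_right_comm, add_assoc]

/-- The general form of the stabilization, used for both operators. -/
theorem rowProd_stable (M : ℤ → Matrix (Fin 2) (Fin 2) R) (l r : ℤ → R) (N : ℕ)
    (hl : ∀ k : ℤ, k ≤ -N → M k 0 0 = l k ∧ M k 0 1 = 0)
    (hr : ∀ k : ℤ, N < k → M k 0 0 = r k ∧ M k 1 0 = 0)
    (p q : ℕ) :
    rowProd M (-((N + p : ℕ) : ℤ) + 1) ((N + p) + (N + q)) 0 0 =
      (∏ i ∈ Finset.range p, l (-((N + i : ℕ) : ℤ))) *
        rowProd M (-(N : ℤ) + 1) (N + N) 0 0 *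
        ∏ i ∈ Finset.range q, r (((N + i : ℕ) : ℤ) + 1) := by
  induction p with
  | zero =>
    induction q with
    | zero => simp
    | succ q ih =>
      rw [Finset.prod_range_succ, ← mul_assoc, ← ih,
        show N + 0 + (N + (q + 1)) = (N + 0 + (N + q)) + 1 by ring, rowProd_add]
      have hk : (-((N + 0 : ℕ) : ℤ) + 1 + ((N + 0 + (N + q) : ℕ) : ℤ)) =
          ((N + q : ℕ) : ℤ) + 1 := by
        push_cast
        ring
      obtain ⟨h1, h2⟩ := hr (((N + q : ℕ) : ℤ) + 1) (by push_cast; omega)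
      rw [hk, Matrix.mul_apply, Fin.sum_univ_two, rowProd, rowProd, Matrix.mul_one, h1, h2,
        mul_zero, add_zero]
  | succ p ih =>
    rw [Finset.prod_range_succ, mul_comm (∏ i ∈ Finset.range p, _), mul_assoc, mul_assoc,
      ← mul_assoc (∏ i ∈ Finset.range p, _), ← ih,
      show N + (p + 1) + (N + q) = (N + p + (N + q)) + 1 by ring, rowProd]
    have hk : (-((N + (p + 1) : ℕ) : ℤ) + 1) = -((N + p : ℕ) : ℤ) := by
      push_cast
      ring
    obtain ⟨h1, h2⟩ := hl (-((N + p : ℕ) : ℤ)) (by push_cast; omega)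
    rw [hk, Matrix.mul_apply, Fin.sum_univ_two, h1, h2, zero_mul, add_zero]

theorem norm_stable (f u v U V : R) (hu : IsUnit (U * u)) (hv : IsUnit (V * v)) :
    u * f * v * Ring.inverse ((U * u) * (V * v)) = f * Ring.inverse (U * V) := by
  have hU : IsUnit (U * V) :=
    (isUnit_of_mul_isUnit_left hu).mul (isUnit_of_mul_isUnit_left hv)
  refine (hu.mul hv).mul_left_injective ?_
  calc u * f * v * Ring.inverse (U * u * (V * v)) * (U * u * (V * v))
      = u * f * v := by rw [mul_assoc, Ring.inverse_mul_cancel _ (hu.mul hv), mul_one]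
    _ = f * (Ring.inverse (U * V) * (U * V)) * (u * v) := by
        rw [Ring.inverse_mul_cancel _ hU]
        ring
    _ = f * Ring.inverse (U * V) * (U * u * (V * v)) := by ring

theorem shiftedPow_add (x : R) (a : ℤ → R) (N p : ℕ) :
    shiftedPow x a (N + p) = shiftedPow x a N *
      ∏ i ∈ Finset.range p, (1 - a (((N + i : ℕ) : ℤ) + 1) * x) := by
  simp only [shiftedPow, Finset.prod_range_add]

theorem shiftedPow_dual_add (y : R) (b : ℤ → R) (N p : ℕ) :
    shiftedPow y (dualSeq b) (N + p) = shiftedPow y (dualSeq b) N *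
      ∏ i ∈ Finset.range p, (1 + b (-((N + i : ℕ) : ℤ)) * y) := by
  rw [shiftedPow_add]
  congr 1
  refine Finset.prod_congr rfl fun i _ => ?_
  rw [dualSeq, show -(((N + i : ℕ) : ℤ) + 1) + 1 = -((N + i : ℕ) : ℤ) by ring]
  ring

theorem isUnit_shiftedPow {x : R} {a : ℤ → R} (h : ∀ k : ℤ, 1 ≤ k → IsUnit (1 - a k * x))
    (n : ℕ) : IsUnit (shiftedPow x a n) := by
  induction n with
  | zero => simp [shiftedPow]
  | succ n ih =>
    rw [shiftedPow, Finset.prod_range_succ]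
    exact ih.mul (h _ (by omega))

theorem isUnit_shiftedPow_dual {y : R} {b : ℤ → R} (h : ∀ k : ℤ, k ≤ 0 → IsUnit (1 + b k * y))
    (n : ℕ) : IsUnit (shiftedPow y (dualSeq b) n) := by
  refine isUnit_shiftedPow (fun k hk => ?_) n
  have := h (-k + 1) (by omega)
  rwa [dualSeq, neg_mul, sub_neg_eq_add]

/-- The normalized coefficients of `A` are constant for large `n`, `m`, and equal to `opA`. -/
theorem normA_eq_opA (a b : ℤ → R) (x y : R) (mu lam : YoungDiagram)
    (hx : ∀ k : ℤ, 1 ≤ k → IsUnit (1 - b k * x)) (hy : ∀ k : ℤ, k ≤ 0 → IsUnit (1 + b k * y))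
    (n m : ℕ) (hn : cutoff mu lam ≤ n) (hm : cutoff mu lam ≤ m) :
    normA a b x y mu lam n m = opA a b x y mu lam := by
  obtain ⟨p, rfl⟩ := Nat.exists_eq_add_of_le hn
  obtain ⟨q, rfl⟩ := Nat.exists_eq_add_of_le hm
  have hc : mu.rowLen 0 ≤ cutoff mu lam ∧ lam.rowLen 0 ≤ cutoff mu lam ∧
      mu.colLen 0 ≤ cutoff mu lam ∧ lam.colLen 0 ≤ cutoff mu lam := by
    simp [cutoff]
  rw [opA, normA, normA, finA, rowProd_stable _ (fun k => 1 + b k * y) (fun k => 1 - b k * x),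
    shiftedPow_dual_add, shiftedPow_add x]
  · refine norm_stable _ _ _ _ _ ?_ ?_
    · rw [← shiftedPow_dual_add]
      exact isUnit_shiftedPow_dual hy _
    · rw [← shiftedPow_add]
      exact isUnit_shiftedPow hx _
  · intro k hk
    rw [occ_left (by omega), occ_left (by omega)]
    simp [vertex]
  · intro k hk
    rw [occ_right (by omega), occ_right (by omega)]
    simp [vertex]

/-- The normalized coefficients of `Â` are constant for large `n`, `m`, and equal to `opAhat`. -/
theorem normAhat_eq_opAhat (a b : ℤ → R) (x y : R) (lam mu : YoungDiagram)
    (hx : ∀ k : ℤ, 1 ≤ k → IsUnit (1 - a k * x)) (hy : ∀ k : ℤ, k ≤ 0 → IsUnit (1 + a k * y))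
    (n m : ℕ) (hn : cutoff lam mu ≤ n) (hm : cutoff lam mu ≤ m) :
    normAhat a b x y lam mu n m = opAhat a b x y lam mu := by
  obtain ⟨p, rfl⟩ := Nat.exists_eq_add_of_le hn
  obtain ⟨q, rfl⟩ := Nat.exists_eq_add_of_le hm
  have hc : mu.rowLen 0 ≤ cutoff lam mu ∧ lam.rowLen 0 ≤ cutoff lam mu ∧
      mu.colLen 0 ≤ cutoff lam mu ∧ lam.colLen 0 ≤ cutoff lam mu := by
    simp [cutoff]
  rw [opAhat, normAhat, normAhat, finAhat,
    rowProd_stable _ (fun k => 1 + a k * y) (fun k => 1 - a k * x),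
    shiftedPow_dual_add, shiftedPow_add x]
  · refine norm_stable _ _ _ _ _ ?_ ?_
    · rw [← shiftedPow_dual_add]
      exact isUnit_shiftedPow_dual hy _
    · rw [← shiftedPow_add]
      exact isUnit_shiftedPow hx _
  · intro k hk
    rw [occ_left (by omega), occ_left (by omega)]
    simp [dualVertex]
  · intro k hk
    rw [occ_right (by omega), occ_right (by omega)]
    simp [dualVertex]

/-! ### The sums over intermediate partitions are finite -/

/-- The number of occupied columns among `k, ..., k+N-1`. -/
def cnt (p : ℤ → Bool) : ℤ → ℕ → ℕ
  | _, 0 => 0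
  | k, N + 1 => (p k).toNat + cnt p (k + 1) N

theorem cnt_eq_card (p : ℤ → Bool) (k : ℤ) (N : ℕ) :
    cnt p k N = ((Finset.Ico k (k + N)).filter fun t => p t = true).card := by
  induction N generalizing k with
  | zero => simp [cnt]
  | succ N ih =>
    have : Finset.Ico k (k + (N + 1 : ℕ)) = insert k (Finset.Ico (k + 1) (k + 1 + N)) := by
      ext t
      simp only [Finset.mem_Ico, Finset.mem_insert]
      push_cast
      omega
    rw [cnt, ih, this, Finset.filter_insert]
    split_ifs with h
    · rw [Finset.card_insert_of_notMem (by simp), h, Bool.toNat_true, add_comm]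
    · simp [h]

/-- Conservation of the number of paths in a row. -/
theorem rowProd_conserve (M : ℤ → Matrix (Fin 2) (Fin 2) R) (p q : ℤ → Bool)
    (hM : ∀ k l r, M k l r ≠ 0 → (l : ℕ) + (p k).toNat = (q k).toNat + r)
    (k : ℤ) (N : ℕ) (l r : Fin 2) (h : rowProd M k N l r ≠ 0) :
    (l : ℕ) + cnt p k N = cnt q k N + r := by
  induction N generalizing k l with
  | zero =>
    have : l = r := by
      by_contra hne
      exact h (by simp [rowProd, hne])
    simp [cnt, this]
  | succ N ih =>
    rw [rowProd, Matrix.mul_apply] at h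
    obtain ⟨j, -, hj⟩ := Finset.exists_ne_zero_of_sum_ne_zero h
    have h1 := hM k l j (left_ne_zero_of_mul hj)
    have h2 := ih (k + 1) j (right_ne_zero_of_mul hj)
    simp only [cnt]
    omega

theorem rowProd_split {M : ℤ → Matrix (Fin 2) (Fin 2) R} {k : ℤ} {N N' : ℕ} {l r : Fin 2}
    (h : rowProd M k (N + N') l r ≠ 0) : ∃ j, rowProd M (k + N) N' j r ≠ 0 := by
  rw [rowProd_add, Matrix.mul_apply] at h
  obtain ⟨j, -, hj⟩ := Finset.exists_ne_zero_of_sum_ne_zero h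
  exact ⟨j, right_ne_zero_of_mul hj⟩

/-- Comparison of Maya diagrams by counting the occupied columns to the right. -/
theorem le_of_cnt_le {mu lam : YoungDiagram} (N : ℕ) (hN : cutoff mu lam ≤ N)
    (h : ∀ p q : ℕ, p + q = N + N → cnt (occ mu) (-(N : ℤ) + 1 + p) q ≤
      cnt (occ lam) (-(N : ℤ) + 1 + p) q) : mu ≤ lam := by
  have hc : mu.rowLen 0 ≤ cutoff mu lam ∧ lam.rowLen 0 ≤ cutoff mu lam ∧
      mu.colLen 0 ≤ cutoff mu lam ∧ lam.colLen 0 ≤ cutoff mu lam := by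
    simp [cutoff]
  suffices hrow : ∀ i, mu.rowLen i ≤ lam.rowLen i by
    rintro ⟨i, j⟩ hij
    exact YoungDiagram.mem_iff_lt_rowLen.2 ((YoungDiagram.mem_iff_lt_rowLen.1 hij).trans_le (hrow i))
  intro i
  by_contra hlt
  push Not at hlt
  have hi : i < mu.colLen 0 :=
    YoungDiagram.mem_iff_lt_colLen.1 (YoungDiagram.mem_iff_lt_rowLen.2 (by omega))
  have hanti := mu.rowLen_anti 0 i (Nat.zero_le _)
  set k : ℤ := (mu.rowLen i : ℤ) - i with hk
  obtain ⟨p, hp⟩ : ∃ p : ℕ, k = -(N : ℤ) + 1 + p :=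
    ⟨(k + N - 1).toNat, by omega⟩
  obtain ⟨q, hq⟩ : ∃ q : ℕ, p + q = N + N := ⟨N + N - p, by omega⟩
  have hcnt := h p q hq
  rw [← hp, cnt_eq_card, cnt_eq_card] at hcnt
  have h1 : (Finset.range (i + 1)).card ≤
      ((Finset.Ico k (k + q)).filter fun t => occ mu t = true).card := by
    refine Finset.card_le_card_of_injOn (fun s => (mu.rowLen s : ℤ) - s) ?_ ?_
    · intro s hs
      simp only [Finset.coe_range, Set.mem_Iio] at hs
      have h2 := mu.rowLen_anti s i (by omega)
      have h3 := mu.rowLen_anti 0 s (Nat.zero_le _)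
      simp only [Finset.coe_filter, Finset.mem_Ico, Set.mem_ofPred_eq]
      refine ⟨⟨by omega, by omega⟩, ?_⟩
      simp only [occ, decide_eq_true_eq]
      exact ⟨s, rfl⟩
    · intro s _ t _ hst
      simp only at hst
      rcases le_total s t with hle | hle
      · have := mu.rowLen_anti s t hle
        omega
      · have := mu.rowLen_anti t s hle
        omega
  have h2 : ((Finset.Ico k (k + q)).filter fun t => occ lam t = true).card ≤
      (Finset.range i).card := by
    have hsub : ((Finset.Ico k (k + q)).filter fun t => occ lam t = true) ⊆
        (Finset.range i).image fun s => (lam.rowLen s : ℤ) - s := by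
      intro t ht
      obtain ⟨hI, ho⟩ := Finset.mem_filter.1 ht
      have h3 := (Finset.mem_Ico.1 hI).1
      simp only [occ, decide_eq_true_eq] at ho
      obtain ⟨s, rfl⟩ := ho
      refine Finset.mem_image.2 ⟨s, Finset.mem_range.2 ?_, rfl⟩
      by_contra hs
      have := lam.rowLen_anti i s (by omega)
      omega
    exact (Finset.card_le_card hsub).trans Finset.card_image_le
  simp only [Finset.card_range] at h1 h2
  omega

/-- `⟨μ| 𝒜 |λ⟩ = 0` unless `μ ⊆ λ`. -/
theorem le_of_opA_ne_zero {a b : ℤ → R} {x y : R} {mu lam : YoungDiagram}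
    (h : opA a b x y mu lam ≠ 0) : mu ≤ lam := by
  refine le_of_cnt_le _ le_rfl fun p q hpq => ?_
  have h0 := left_ne_zero_of_mul h
  rw [finA, ← hpq] at h0
  obtain ⟨j, hj⟩ := rowProd_split h0
  have := rowProd_conserve _ (occ mu) (occ lam) (fun k l r hne => ?_) _ _ _ _ hj
  · simp only [Fin.val_zero, add_zero] at this
    omega
  · revert hne
    cases occ mu k <;> cases occ lam k <;> fin_cases l <;> fin_cases r <;> simp [vertex]

/-- `⟨λ| 𝒜̂ |μ⟩ = 0` unless `μ ⊆ λ`. -/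
theorem le_of_opAhat_ne_zero {a b : ℤ → R} {x y : R} {lam mu : YoungDiagram}
    (h : opAhat a b x y lam mu ≠ 0) : mu ≤ lam := by
  have hcomm : cutoff mu lam = cutoff lam mu := max_comm _ _
  refine le_of_cnt_le _ hcomm.le fun p q hpq => ?_
  have h0 := left_ne_zero_of_mul h
  rw [finAhat, ← hpq] at h0
  obtain ⟨j, hj⟩ := rowProd_split h0
  have := rowProd_conserve _ (occ mu) (occ lam) (fun k l r hne => ?_) _ _ _ _ hj
  · simp only [Fin.val_zero, add_zero] at this
    omega
  · revert hne
    cases occ mu k <;> cases occ lam k <;> fin_cases l <;> fin_cases r <;> simp [dualVertex]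

theorem finite_le (lam : YoungDiagram) : {mu : YoungDiagram | mu ≤ lam}.Finite := by
  refine Set.Finite.of_injOn (f := YoungDiagram.cells) (t := ↑lam.cells.powerset) ?_ ?_
    (Finset.finite_toSet _)
  · intro mu hmu
    simpa using YoungDiagram.cells_subset_iff.2 hmu
  · intro s _ t _ hst
    exact YoungDiagram.ext hst

theorem exists_ne_zero_of_finsum {f : YoungDiagram → R} (h : ∑ᶠ kap, f kap ≠ 0) :
    ∃ kap, f kap ≠ 0 := by
  by_contra hf
  push Not at hf
  exact h (by simp [hf])

/-- `s_{λ/μ} = 0` unless `μ ⊆ λ`. -/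
theorem le_of_schur_ne_zero {n : ℕ} {a b : ℤ → R} {x y : Fin n → R} {lam mu : YoungDiagram}
    (h : schur a b x y lam mu ≠ 0) : mu ≤ lam := by
  induction n generalizing mu with
  | zero =>
    by_contra hne
    exact h (if_neg fun he => hne he.le)
  | succ n ih =>
    obtain ⟨kap, hk⟩ := exists_ne_zero_of_finsum h
    exact (le_of_opA_ne_zero (left_ne_zero_of_mul hk)).trans
      (ih (x := fun i => x i.succ) (y := fun i => y i.succ) (right_ne_zero_of_mul hk))

/-- `ŝ_{λ/μ} = 0` unless `μ ⊆ λ`. -/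
theorem le_of_dualSchur_ne_zero {n : ℕ} {a b : ℤ → R} {x y : Fin n → R} {lam mu : YoungDiagram}
    (h : dualSchur a b x y lam mu ≠ 0) : mu ≤ lam := by
  induction n generalizing lam with
  | zero =>
    by_contra hne
    exact h (if_neg fun he => hne he.ge)
  | succ n ih =>
    obtain ⟨kap, hk⟩ := exists_ne_zero_of_finsum h
    exact (ih (x := fun i => x i.succ) (y := fun i => y i.succ) (right_ne_zero_of_mul hk)).trans
      (le_of_opAhat_ne_zero (left_ne_zero_of_mul hk))

/-- The sum over `κ` in the definition of `s_{λ/μ}` is finite. -/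
theorem finite_schur_sum {n : ℕ} (a b : ℤ → R) (x y : Fin (n + 1) → R) (lam mu : YoungDiagram) :
    (Function.support fun kap : YoungDiagram => opA a b (x 0) (y 0) mu kap *
      schur a b (fun i => x i.succ) (fun i => y i.succ) lam kap).Finite :=
  (finite_le lam).subset fun _ hk => le_of_schur_ne_zero (right_ne_zero_of_mul hk)

/-- The sum over `κ` in the definition of `ŝ_{λ/μ}` is finite. -/
theorem finite_dualSchur_sum {n : ℕ} (a b : ℤ → R) (x y : Fin (n + 1) → R)
    (lam mu : YoungDiagram) :
    (Function.support fun kap : YoungDiagram => opAhat a b (x 0) (y 0) lam kap *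
      dualSchur a b (fun i => x i.succ) (fun i => y i.succ) kap mu).Finite :=
  (finite_le lam).subset fun _ hk => le_of_opAhat_ne_zero (left_ne_zero_of_mul hk)

/-- The sum over `ρ` of `ŝ_{μ/ρ} s_{ν/ρ}` is finite. -/
theorem finite_rho_sum {n m : ℕ} (a b : ℤ → R) (x y : Fin n → R) (z w : Fin m → R)
    (mu nu : YoungDiagram) :
    (Function.support fun rho : YoungDiagram =>
      dualSchur a b z w mu rho * schur a b x y nu rho).Finite :=
  (finite_le nu).subset fun _ hk => le_of_schur_ne_zero (right_ne_zero_of_mul hk)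

end FreeFermionic

end

/-! The source of the identity is a Yang-Baxter equation. Stack a standard row on a dual row and sum
over the vertical edges between them. The 4 × 4 matrix `crossDual` of one crossing, which does not
depend on `a_k`, `b_k`, intertwines this pair with the pair in the opposite order, column by column
and hence for a whole window `-N+1, ..., N` (`pairMat_crossDual`, `gridProd_intertwine`).
Conservation of the number of paths turns the sum over the middle edges into a sum over the
partitions in an `N × N` box. Two entries of the matrix identity, combined through `(1-xz)(1-yw) +
(x+y)(z+w) = (1+yz)(1+xw)`, give the one-row Cauchy identity up to boundary terms in which both
horizontal edges are occupied at an end of the window (`sum_finA_finAhat_exchange`).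

For indeterminates, let `J` be the ideal of power series without constant term. Far from `μ` and `ν`
a doubly occupied pair of edges in a boundary term can only persist, at the cost of a factor in `J`
per column; so the boundary terms of a window enlarged by `d` lie in `J^d` (`exchange_mem_pow`).
Similarly, the coefficients from `μ` to `λ` lie in a power of `J` that grows with `λ`
(`opA_mem_pow`), because the paths must cover the added distance along horizontal edges. This gives
the convergent one-row identity, and associativity in the incidence algebra of Young's lattice
extends it to several rows (`CauchyPair.mul_left`).

For values in a field, the sum is finite because a horizontal weight vanishes: if `x_i = a_l`, no
path crosses the column `l` to the right of `μ`, and if `y_i = a'_l`, none crosses the column `1-l`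
to the left. With several rows this bounds `λ` when the `l_i` increase; the rows commute by a second
Yang-Baxter equation (`commute_incA`), so they can be sorted. Commutation requires some nonvanishing
and is therefore used for generic specializations in the power series ring. The finite identity
obtained there holds in a localization of the polynomial ring, which embeds into power series and
also maps to the field (`finsum_schur_mul_dualSchur_of_polynomial`). -/

noncomputable section

namespace FreeFermionic

variable {R : Type*} [CommRing R]

/-! ### Maya diagrams in a finite window -/

/-- The side of the smallest square that contains `λ`. -/
def extent (lam : YoungDiagram) : ℕ := max (lam.rowLen 0) (lam.colLen 0)

theorem extent_mono {lam mu : YoungDiagram} (h : lam ≤ mu) : extent lam ≤ extent mu := by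
  refine max_le_max ?_ ?_
  · by_contra hlt
    have h1 : (0, mu.rowLen 0) ∈ lam := YoungDiagram.mem_iff_lt_rowLen.2 (by omega)
    have := YoungDiagram.mem_iff_lt_rowLen.1 (h h1)
    omega
  · by_contra hlt
    have h1 : (mu.colLen 0, 0) ∈ lam := YoungDiagram.mem_iff_lt_colLen.2 (by omega)
    have := YoungDiagram.mem_iff_lt_colLen.1 (h h1)
    omega

theorem finite_bounded (p q : ℕ) :
    {lam : YoungDiagram | lam.rowLen 0 ≤ p ∧ lam.colLen 0 ≤ q}.Finite := by
  refine Set.Finite.of_injOn (f := YoungDiagram.cells)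
    (t := ↑(Finset.range q ×ˢ Finset.range p).powerset) ?_ ?_ (Finset.finite_toSet _)
  · rintro lam ⟨hp, hq⟩
    simp only [Finset.coe_powerset, Set.mem_preimage, Set.mem_powerset_iff, Finset.coe_subset]
    rintro ⟨i, j⟩ hij
    rw [YoungDiagram.mem_cells] at hij
    have h1 := YoungDiagram.mem_iff_lt_rowLen.1 (lam.up_left_mem (Nat.zero_le i) le_rfl hij)
    have h2 := YoungDiagram.mem_iff_lt_colLen.1 (lam.up_left_mem le_rfl (Nat.zero_le j) hij)
    exact Finset.mem_product.2 ⟨Finset.mem_range.2 (by simp; omega),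
      Finset.mem_range.2 (by simp; omega)⟩
  · intro s _ t _ hst
    exact YoungDiagram.ext hst

theorem finite_extent_le (N : ℕ) : {lam : YoungDiagram | extent lam ≤ N}.Finite :=
  (finite_bounded N N).subset fun _ h => max_le_iff.1 h

/-- The Young diagrams in an `N × N` square. -/
def box (N : ℕ) : Finset YoungDiagram := (finite_extent_le N).toFinset

@[simp]
theorem mem_box {N : ℕ} {lam : YoungDiagram} : lam ∈ box N ↔ extent lam ≤ N := by
  simp [box]

/-- The columns `-N+1, ..., N`. -/
def window (N : ℕ) : Finset ℤ := Finset.Ico (-(N : ℤ) + 1) (-(N : ℤ) + 1 + ((N + N : ℕ) : ℤ))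

theorem mem_window {N : ℕ} {k : ℤ} : k ∈ window N ↔ -(N : ℤ) < k ∧ k ≤ N := by
  simp only [window, Finset.mem_Ico]
  push_cast
  omega

/-- The occupied columns among `-N+1, ..., N`. -/
def occSet (N : ℕ) (lam : YoungDiagram) : Finset ℤ := (window N).filter fun k => occ lam k = true

theorem occ_iff {lam : YoungDiagram} {k : ℤ} :
    occ lam k = true ↔ ∃ i : ℕ, k = (lam.rowLen i : ℤ) - i := by
  simp [occ]

theorem strictAnti_occ (lam : YoungDiagram) :
    StrictAnti fun i : ℕ => (lam.rowLen i : ℤ) - i := by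
  intro i j hij
  have := lam.rowLen_anti i j hij.le
  simp only
  omega

theorem rowLen_eq_zero_of_colLen_le {lam : YoungDiagram} {i : ℕ} (h : lam.colLen 0 ≤ i) :
    lam.rowLen i = 0 := by
  by_contra hne
  have h1 : (i, 0) ∈ lam := YoungDiagram.mem_iff_lt_rowLen.2 (Nat.pos_of_ne_zero hne)
  have h2 := YoungDiagram.mem_iff_lt_colLen.1 h1
  omega

/-- The particle `λ_i - i`, with rows numbered from `0`, lies in the window exactly when `i < N`:
the rows from `N` on are empty, so their particles sit at `-i ≤ -N`. -/
theorem card_occSet {N : ℕ} {lam : YoungDiagram} (h : extent lam ≤ N) :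
    (occSet N lam).card = N := by
  obtain ⟨hr, hc⟩ := max_le_iff.1 h
  have : occSet N lam = (Finset.range N).image fun i : ℕ => (lam.rowLen i : ℤ) - i := by
    ext k
    simp only [occSet, Finset.mem_filter, mem_window, occ_iff, Finset.mem_image, Finset.mem_range]
    constructor
    · rintro ⟨⟨h1, h2⟩, i, rfl⟩
      refine ⟨i, ?_, rfl⟩
      by_contra hi
      rw [rowLen_eq_zero_of_colLen_le (by omega : lam.colLen 0 ≤ i)] at h1
      omega
    · rintro ⟨i, hi, rfl⟩
      have := lam.rowLen_anti 0 i (Nat.zero_le _)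
      exact ⟨⟨by omega, by omega⟩, i, rfl⟩
  rw [this, Finset.card_image_of_injective _ (strictAnti_occ lam).injective, Finset.card_range]

theorem le_of_occ_eq {lam mu : YoungDiagram} (h : occ lam = occ mu) : lam ≤ mu :=
  le_of_cnt_le _ le_rfl fun _ _ _ => by rw [h]

theorem occ_injective : Function.Injective occ := fun _ _ h =>
  le_antisymm (le_of_occ_eq h) (le_of_occ_eq h.symm)

theorem occSet_injOn (N : ℕ) : Set.InjOn (occSet N) {lam | extent lam ≤ N} := by
  intro lam hl mu hm h
  obtain ⟨hl1, hl2⟩ := max_le_iff.1 (show extent lam ≤ N from hl)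
  obtain ⟨hm1, hm2⟩ := max_le_iff.1 (show extent mu ≤ N from hm)
  refine occ_injective (funext fun k => ?_)
  by_cases hk : k ∈ window N
  · have h1 := Finset.ext_iff.1 h k
    simp only [occSet, Finset.mem_filter, hk, true_and] at h1
    exact Bool.eq_iff_iff.2 h1
  · rw [mem_window, not_and_or, not_lt, not_le] at hk
    rcases hk with hk | hk
    · rw [occ_left (by omega), occ_left (by omega)]
    · rw [occ_right (by omega), occ_right (by omega)]

theorem add_sub_le_of_strictMono {N : ℕ} {e : Fin N → ℤ} (he : StrictMono e) {i j : Fin N}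
    (h : i ≤ j) : e i + ((j : ℤ) - i) ≤ e j := by
  obtain ⟨j, hj⟩ := j
  obtain ⟨d, hd⟩ := Nat.exists_eq_add_of_le (show (i : ℕ) ≤ j from h)
  subst hd
  induction d with
  | zero => simp
  | succ d ih =>
    have h1 := ih (by omega) (Fin.le_def.2 (by simp))
    have h2 := he (show (⟨i + d, by omega⟩ : Fin N) < ⟨i + (d + 1), hj⟩ from
      Fin.lt_def.2 (by simp))
    push_cast at h1 ⊢
    omega

/-- Read the `N` positions from right to left. Adding `i` to the `i`-th one undoes the strict
decrease and gives the row lengths of a partition. -/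
theorem exists_occSet_eq {N : ℕ} {s : Finset ℤ} (hs : s ⊆ window N) (hcard : s.card = N) :
    ∃ lam : YoungDiagram, extent lam ≤ N ∧ occSet N lam = s := by
  classical
  set e := s.orderEmbOfFin hcard with he
  have hwin : ∀ i, -(N : ℤ) < e i ∧ e i ≤ N := fun i =>
    mem_window.1 (hs (Finset.orderEmbOfFin_mem s hcard i))
  have hgap : ∀ i j : Fin N, i ≤ j → e i + ((j : ℤ) - i) ≤ e j := fun i j h =>
    add_sub_le_of_strictMono e.strictMono h
  have hlow : ∀ i : Fin N, -(N : ℤ) + 1 + i ≤ e i := fun i => by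
    have h1 := hgap ⟨0, i.pos⟩ i (Fin.le_def.2 (Nat.zero_le _))
    have h2 := hwin ⟨0, i.pos⟩
    simp only [Nat.cast_zero] at h1
    omega
  -- The enumeration `e` is increasing, hence `Fin.rev`. By `hlow` the sums are positive, so `toNat`
  -- loses nothing.
  set w : List ℕ := List.ofFn fun i : Fin N => (e i.rev + i).toNat with hw
  have hsort : w.SortedGE := by
    refine (List.sortedGE_ofFn_iff).2 fun i j hij => ?_
    have h1 := hgap j.rev i.rev (Fin.rev_le_rev.2 hij)
    have h2 := Fin.val_rev i
    have h3 := Fin.val_rev j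
    have := Fin.le_def.1 hij
    omega
  have hlen : w.length = N := by simp [hw]
  set lam := YoungDiagram.ofRowLens w hsort with hlam
  have hmem : ∀ i j : ℕ, (i, j) ∈ lam ↔ ∃ h : i < N, (j : ℤ) < e (Fin.rev ⟨i, h⟩) + i := by
    intro i j
    rw [hlam, YoungDiagram.mem_ofRowLens]
    simp only [hlen]
    refine exists_congr fun h => ?_
    simp only [hw, List.getElem_ofFn]
    omega
  have hrow : ∀ (i : ℕ) (h : i < N), (lam.rowLen i : ℤ) = e (Fin.rev ⟨i, h⟩) + i := by
    intro i h
    have h1 := hlow (Fin.rev ⟨i, h⟩)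
    rw [Fin.val_rev] at h1
    simp only at h1
    refine le_antisymm ?_ ?_
    · by_contra hlt
      push Not at hlt
      have h2 := (hmem i (e (Fin.rev ⟨i, h⟩) + i).toNat).1
        (YoungDiagram.mem_iff_lt_rowLen.2 (by omega))
      obtain ⟨_, h3⟩ := h2
      omega
    · by_contra hlt
      push Not at hlt
      have h2 := YoungDiagram.mem_iff_lt_rowLen.1 ((hmem i (lam.rowLen i)).2 ⟨h, hlt⟩)
      omega
  have hcol : lam.colLen 0 ≤ N := by
    by_contra hlt
    push Not at hlt
    obtain ⟨h, -⟩ := (hmem N 0).1 (YoungDiagram.mem_iff_lt_colLen.2 hlt)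
    omega
  have hrow0 : lam.rowLen 0 ≤ N := by
    rcases Nat.eq_zero_or_pos N with h0 | h0
    · rw [rowLen_eq_zero_of_colLen_le (by omega)]
      omega
    · have h1 := hrow 0 h0
      have h2 := hwin (Fin.rev ⟨0, h0⟩)
      omega
  refine ⟨lam, max_le hrow0 hcol, ?_⟩
  ext k
  simp only [occSet, Finset.mem_filter, mem_window, occ_iff]
  constructor
  · rintro ⟨⟨h1, h2⟩, i, rfl⟩
    have hi : i < N := by
      by_contra hi
      rw [rowLen_eq_zero_of_colLen_le (by omega : lam.colLen 0 ≤ i)] at h1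
      omega
    rw [hrow i hi, add_sub_cancel_right]
    exact Finset.orderEmbOfFin_mem s hcard _
  · intro hk
    refine ⟨mem_window.1 (hs hk), ?_⟩
    have : k ∈ Set.range e := by
      rw [he, Finset.range_orderEmbOfFin]
      exact hk
    obtain ⟨j, rfl⟩ := this
    refine ⟨j.rev, ?_⟩
    rw [hrow _ j.rev.isLt, Fin.eta, Fin.rev_rev, add_sub_cancel_right]

/-- A sum over the configurations of a row with the right number of paths is a sum over Young
diagrams. -/
theorem sum_powerset_window {M : Type*} [AddCommMonoid M] (N : ℕ) (f : Finset ℤ → M)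
    (hf : ∀ s ⊆ window N, f s ≠ 0 → s.card = N) :
    ∑ s ∈ (window N).powerset, f s = ∑ lam ∈ box N, f (occSet N lam) := by
  rw [← Finset.sum_subset (show (window N).powersetCard N ⊆ (window N).powerset from
    fun s hs => Finset.mem_powerset.2 (Finset.mem_powersetCard.1 hs).1)]
  · symm
    refine Finset.sum_nbij (occSet N) ?_ ?_ ?_ fun _ _ => rfl
    · intro lam h
      exact Finset.mem_powersetCard.2 ⟨Finset.filter_subset _ _, card_occSet (mem_box.1 h)⟩
    · intro lam h mu h'
      exact occSet_injOn N (mem_box.1 h) (mem_box.1 h')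
    · intro s hs
      obtain ⟨h1, h2⟩ := Finset.mem_powersetCard.1 hs
      obtain ⟨lam, h3, h4⟩ := exists_occSet_eq h1 h2
      exact ⟨lam, mem_box.2 h3, h4⟩
  · intro s hs hn
    by_contra h
    exact hn (Finset.mem_powersetCard.2
      ⟨Finset.mem_powerset.1 hs, hf s (Finset.mem_powerset.1 hs) h⟩)

/-! ### Pairs of rows and the Yang-Baxter equations -/

open scoped Kronecker

/-- The row with the `N` columns `k, ..., k+N-1` for an arbitrary set of horizontal states. -/
def gridProd {ι : Type*} [Fintype ι] [DecidableEq ι] (M : ℤ → Matrix ι ι R) :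
    ℤ → ℕ → Matrix ι ι R
  | _, 0 => 1
  | k, N + 1 => M k * gridProd M (k + 1) N

section gridProd

variable {ι : Type*} [Fintype ι] [DecidableEq ι]

theorem gridProd_add (M : ℤ → Matrix ι ι R) (k : ℤ) (N N' : ℕ) :
    gridProd M k (N + N') = gridProd M k N * gridProd M (k + N) N' := by
  induction N generalizing k with
  | zero => simp [gridProd]
  | succ N ih =>
    rw [Nat.add_right_comm, gridProd, gridProd, ih, Matrix.mul_assoc]
    push_cast
    rw [add_right_comm, add_assoc]

/-- The train argument: the same crossing `T` is pulled through one column after another, which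
works because `T` does not depend on the column. -/
theorem gridProd_intertwine {M M' : ℤ → Matrix ι ι R} {T : Matrix ι ι R}
    (h : ∀ k, M k * T = T * M' k) (k : ℤ) (N : ℕ) :
    gridProd M k N * T = T * gridProd M' k N := by
  induction N generalizing k with
  | zero => simp [gridProd]
  | succ N ih =>
    rw [gridProd, gridProd, Matrix.mul_assoc, ih, ← Matrix.mul_assoc, h, Matrix.mul_assoc]

/-- If nothing but `e` can lead to `e`, only `e` leads to `e` in a whole row. -/
theorem gridProd_apply_right {M : ℤ → Matrix ι ι R} {e : ι} {k : ℤ} {N : ℕ}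
    (h : ∀ t, k ≤ t → ∀ i, i ≠ e → M t i e = 0) (i : ι) :
    gridProd M k N i e = if i = e then ∏ t ∈ Finset.range N, M (k + t) e e else 0 := by
  induction N generalizing k i with
  | zero => simp [gridProd, Matrix.one_apply]
  | succ N ih =>
    rw [gridProd, Matrix.mul_apply, Finset.sum_eq_single e]
    · rw [ih fun t ht => h t (by omega), if_pos rfl, Finset.prod_range_succ']
      split_ifs with hi
      · subst hi
        rw [mul_comm]
        push_cast
        simp only [add_assoc, add_comm (1 : ℤ), add_zero]
      · rw [h k le_rfl i hi, zero_mul]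
    · intro j _ hj
      rw [ih fun t ht => h t (by omega), if_neg hj, mul_zero]
    · simp

/-- If `e` leads to nothing but `e`, it leads only to `e` in a whole row. -/
theorem gridProd_apply_left {M : ℤ → Matrix ι ι R} {e : ι} {k : ℤ} {N : ℕ}
    (h : ∀ t, t < k + N → ∀ i, i ≠ e → M t e i = 0) (i : ι) :
    gridProd M k N e i = if i = e then ∏ t ∈ Finset.range N, M (k + t) e e else 0 := by
  induction N generalizing k with
  | zero => simp [gridProd, Matrix.one_apply, eq_comm]
  | succ N ih =>
    rw [gridProd, Matrix.mul_apply, Finset.sum_eq_single e]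
    · rw [ih fun t ht => h t (by push_cast; omega), Finset.prod_range_succ']
      split_ifs with hi
      · rw [mul_comm]
        push_cast
        simp only [add_assoc, add_comm (1 : ℤ), add_zero]
      · rw [mul_zero]
    · intro j _ hj
      rw [h k (by push_cast; omega) j hj, zero_mul]
    · simp

end gridProd

theorem rowProd_congr {M M' : ℤ → Matrix (Fin 2) (Fin 2) R} {k : ℤ} {N : ℕ}
    (h : ∀ t ∈ Finset.Ico k (k + N), M t = M' t) : rowProd M k N = rowProd M' k N := by
  induction N generalizing k with
  | zero => rfl
  | succ N ih =>
    rw [rowProd, rowProd, h k (by simp), ih fun t ht => h t ?_]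
    simp only [Finset.mem_Ico] at ht ⊢
    push_cast
    omega

/-- Two vertices on top of each other, summed over the edge between them. -/
def pairMat (M N : Bool → Matrix (Fin 2) (Fin 2) R) : Matrix (Fin 2 × Fin 2) (Fin 2 × Fin 2) R :=
  M false ⊗ₖ N false + M true ⊗ₖ N true

/-- Expanding the product of sums chooses the set `s` of occupied middle edges; for each choice the
two rows decouple into a Kronecker product. -/
theorem gridProd_pairMat (M N : ℤ → Bool → Matrix (Fin 2) (Fin 2) R) (k : ℤ) (n : ℕ) :
    gridProd (fun t => pairMat (M t) (N t)) k n =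
      ∑ s ∈ (Finset.Ico k (k + n)).powerset,
        rowProd (fun t => M t (decide (t ∈ s))) k n ⊗ₖ
          rowProd (fun t => N t (decide (t ∈ s))) k n := by
  induction n generalizing k with
  | zero => simp [gridProd, rowProd]
  | succ n ih =>
    have hI : Finset.Ico k (k + (n + 1 : ℕ)) = insert k (Finset.Ico (k + 1) (k + 1 + n)) := by
      ext t
      simp only [Finset.mem_Ico, Finset.mem_insert]
      push_cast
      omega
    have hk : k ∉ Finset.Ico (k + 1) (k + 1 + (n : ℤ)) := by simp
    rw [hI, Finset.sum_powerset_insert hk, gridProd, ih, Finset.mul_sum, ← Finset.sum_add_distrib]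
    refine Finset.sum_congr rfl fun s hs => ?_
    have hks : k ∉ s := fun h => hk (Finset.mem_powerset.1 hs h)
    have hins : ∀ L : ℤ → Bool → Matrix (Fin 2) (Fin 2) R,
        rowProd (fun t => L t (decide (t ∈ insert k s))) (k + 1) n =
          rowProd (fun t => L t (decide (t ∈ s))) (k + 1) n := by
      intro L
      refine rowProd_congr fun t ht => ?_
      have : t ≠ k := by
        simp only [Finset.mem_Ico] at ht
        omega
      simp [this]
    simp only [rowProd, hins, hks, Finset.mem_insert_self, decide_true, decide_false, pairMat,
      Matrix.add_mul, Matrix.mul_kronecker_mul]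

theorem decide_mem_occSet {N : ℕ} {lam : YoungDiagram} {k : ℤ} (hk : k ∈ window N) :
    decide (k ∈ occSet N lam) = occ lam k := by
  simp [occSet, hk]

theorem cnt_window {N : ℕ} {lam : YoungDiagram} (h : extent lam ≤ N) :
    cnt (occ lam) (-(N : ℤ) + 1) (N + N) = N := by
  rw [cnt_eq_card]
  exact card_occSet h

/-- The hypothesis leaves only middle configurations with `N` particles, and these are the Maya
diagrams of the partitions in the box. -/
theorem gridProd_pairMat_window (M P : ℤ → Bool → Matrix (Fin 2) (Fin 2) R) (N : ℕ)
    (h : ∀ p : ℤ → Bool, rowProd (fun t => M t (p t)) (-(N : ℤ) + 1) (N + N) 0 0 ≠ 0 →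
      cnt p (-(N : ℤ) + 1) (N + N) = N) :
    gridProd (fun t => pairMat (M t) (P t)) (-(N : ℤ) + 1) (N + N) (0, 0) (0, 0) =
      ∑ lam ∈ box N, rowProd (fun t => M t (occ lam t)) (-(N : ℤ) + 1) (N + N) 0 0 *
        rowProd (fun t => P t (occ lam t)) (-(N : ℤ) + 1) (N + N) 0 0 := by
  rw [gridProd_pairMat, Matrix.sum_apply]
  simp only [Matrix.kroneckerMap_apply]
  have := sum_powerset_window N (fun s =>
    rowProd (fun t => M t (decide (t ∈ s))) (-(N : ℤ) + 1) (N + N) 0 0 *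
      rowProd (fun t => P t (decide (t ∈ s))) (-(N : ℤ) + 1) (N + N) 0 0) ?_
  · have hL : ∀ (L : ℤ → Bool → Matrix (Fin 2) (Fin 2) R) (lam : YoungDiagram),
        rowProd (fun t => L t (decide (t ∈ occSet N lam))) (-(N : ℤ) + 1) (N + N) =
          rowProd (fun t => L t (occ lam t)) (-(N : ℤ) + 1) (N + N) := fun L lam =>
      rowProd_congr fun t ht => by rw [decide_mem_occSet ht]
    simp only [hL] at this
    exact this
  · intro s hs hne
    have h1 := h _ (left_ne_zero_of_mul hne)
    rw [cnt_eq_card] at h1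
    simp only [decide_eq_true_eq] at h1
    rw [Finset.filter_mem_eq_inter,
      show Finset.Ico _ _ ∩ s = s from Finset.inter_eq_right.2 hs] at h1
    exact h1

theorem vertex_conserve (x y a b : R) (s t : Bool) (l r : Fin 2)
    (h : vertex x y a b s t l r ≠ 0) : (l : ℕ) + s.toNat = t.toNat + r := by
  revert h
  cases s <;> cases t <;> fin_cases l <;> fin_cases r <;> simp [vertex]

/-- The pair of a standard row above a dual row. -/
def upperLower (a b : ℤ → R) (x y z w : R) (mu nu : YoungDiagram) (k : ℤ) :
    Matrix (Fin 2 × Fin 2) (Fin 2 × Fin 2) R :=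
  pairMat (vertex x y (a k) (b k) (occ mu k)) fun s => dualVertex z w (a k) (b k) s (occ nu k)

/-- The intertwiner between a standard row and a dual row. -/
def crossDual (x y z w : R) : Matrix (Fin 2 × Fin 2) (Fin 2 × Fin 2) R :=
  (1 - x * z) • (!![1, 0; 0, 0] ⊗ₖ !![1, 0; 0, 0]) + (z + w) • (!![0, 1; 0, 0] ⊗ₖ !![0, 1; 0, 0]) +
  (1 + y * z) • (!![1, 0; 0, 0] ⊗ₖ !![0, 0; 0, 1]) +
  (1 + x * w) • (!![0, 0; 0, 1] ⊗ₖ !![1, 0; 0, 0]) +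
  (x + y) • (!![0, 0; 1, 0] ⊗ₖ !![0, 0; 1, 0]) - (1 - y * w) • (!![0, 0; 0, 1] ⊗ₖ !![0, 0; 0, 1])

/-- The intertwiner between two standard rows. -/
def cross (x y z w : R) : Matrix (Fin 2 × Fin 2) (Fin 2 × Fin 2) R :=
  (y + z) • (!![1, 0; 0, 0] ⊗ₖ !![1, 0; 0, 0]) + (z - x) • (!![1, 0; 0, 0] ⊗ₖ !![0, 0; 0, 1]) +
  (z + w) • (!![0, 1; 0, 0] ⊗ₖ !![0, 0; 1, 0]) + (x + y) • (!![0, 0; 1, 0] ⊗ₖ !![0, 1; 0, 0]) +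
  (y - w) • (!![0, 0; 0, 1] ⊗ₖ !![1, 0; 0, 0]) + (x + w) • (!![0, 0; 0, 1] ⊗ₖ !![0, 0; 0, 1])

set_option maxHeartbeats 2000000 in
-- The Yang-Baxter equation for a standard and a dual vertex: for each choice of outer vertical
-- edges, 16 polynomial identities in the weights.
theorem pairMat_crossDual (x y z w a b : R) (s t : Bool) :
    pairMat (vertex x y a b s) (fun u => dualVertex z w a b u t) * crossDual x y z w =
      crossDual x y z w * pairMat (fun u => vertex x y a b u t) (dualVertex z w a b s) := by
  ext ⟨i, j⟩ ⟨k, l⟩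
  cases s <;> cases t <;> fin_cases i <;> fin_cases j <;> fin_cases k <;> fin_cases l <;>
    simp [Matrix.mul_apply, Fintype.sum_prod_type, Fin.sum_univ_two, crossDual, pairMat, vertex,
      dualVertex] <;> ring

set_option maxHeartbeats 2000000 in
theorem pairMat_cross (x y z w a b : R) (s t : Bool) :
    pairMat (vertex x y a b s) (fun u => vertex z w a b u t) * cross x y z w =
      cross x y z w * pairMat (fun u => vertex x y a b u t) (vertex z w a b s) := by
  ext ⟨i, j⟩ ⟨k, l⟩
  cases s <;> cases t <;> fin_cases i <;> fin_cases j <;> fin_cases k <;> fin_cases l <;>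
    simp [Matrix.mul_apply, Fintype.sum_prod_type, Fin.sum_univ_two, cross, pairMat, vertex] <;>
    ring

theorem cnt_eq_of_finA {a b : ℤ → R} {x y : R} {N : ℕ} {p q : ℤ → Bool}
    (h : rowProd (fun k => vertex x y (a k) (b k) (p k) (q k)) (-(N : ℤ) + 1) (N + N) 0 0 ≠ 0) :
    cnt p (-(N : ℤ) + 1) (N + N) = cnt q (-(N : ℤ) + 1) (N + N) := by
  simpa using rowProd_conserve _ p q (fun k l r => vertex_conserve _ _ _ _ _ _ l r) _ _ _ _ h

theorem sum_finA_finAhat (a b : ℤ → R) (x y z w : R) {mu nu : YoungDiagram} {N : ℕ}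
    (hmu : extent mu ≤ N) :
    ∑ lam ∈ box N, finA a b x y mu lam N N * finAhat a b z w lam nu N N =
      gridProd (upperLower a b x y z w mu nu) (-(N : ℤ) + 1) (N + N) (0, 0) (0, 0) := by
  refine (gridProd_pairMat_window (fun k => vertex x y (a k) (b k) (occ mu k))
    (fun k s => dualVertex z w (a k) (b k) s (occ nu k)) N fun p hp => ?_).symm
  rw [← cnt_eq_of_finA hp, cnt_window hmu]

theorem sum_finAhat_finA (a b : ℤ → R) (x y z w : R) {mu nu : YoungDiagram} {N : ℕ}
    (hnu : extent nu ≤ N) :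
    ∑ rho ∈ box N, finAhat a b z w mu rho N N * finA a b x y rho nu N N =
      gridProd (fun k => pairMat (fun s => vertex x y (a k) (b k) s (occ nu k))
        (dualVertex z w (a k) (b k) (occ mu k))) (-(N : ℤ) + 1) (N + N) (0, 0) (0, 0) := by
  rw [gridProd_pairMat_window (fun k s => vertex x y (a k) (b k) s (occ nu k))
    (fun k => dualVertex z w (a k) (b k) (occ mu k)) N fun p hp => ?_]
  · exact Finset.sum_congr rfl fun _ _ => mul_comm _ _
  · rw [cnt_eq_of_finA hp, cnt_window hnu]

/-- The exchange of a standard row and a dual row, with its boundary terms. -/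
theorem sum_finA_finAhat_exchange (a b : ℤ → R) (x y z w : R) {mu nu : YoungDiagram} {N : ℕ}
    (hmu : extent mu ≤ N) (hnu : extent nu ≤ N) :
    (1 - x * z) * (1 - y * w) *
        ∑ lam ∈ box N, finA a b x y mu lam N N * finAhat a b z w lam nu N N +
      ((1 - y * w) * (x + y) *
          gridProd (upperLower a b x y z w mu nu) (-(N : ℤ) + 1) (N + N) (0, 0) (1, 1) +
        (z + w) * (1 - x * z) *
          gridProd (upperLower a b x y z w mu nu) (-(N : ℤ) + 1) (N + N) (1, 1) (0, 0) +
        (z + w) * (x + y) *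
          gridProd (upperLower a b x y z w mu nu) (-(N : ℤ) + 1) (N + N) (1, 1) (1, 1)) =
      (1 + y * z) * (1 + x * w) *
        ∑ rho ∈ box N, finAhat a b z w mu rho N N * finA a b x y rho nu N N := by
  rw [sum_finA_finAhat _ _ _ _ _ _ hmu, sum_finAhat_finA _ _ _ _ _ _ hnu]
  have h := gridProd_intertwine (M := upperLower a b x y z w mu nu)
    (M' := fun k => pairMat (fun s => vertex x y (a k) (b k) s (occ nu k))
        (dualVertex z w (a k) (b k) (occ mu k))) (T := crossDual x y z w)
    (fun k => pairMat_crossDual _ _ _ _ _ _ _ _) (-(N : ℤ) + 1) (N + N)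
  have h1 := congrFun (congrFun h (0, 0)) (0, 0)
  have h2 := congrFun (congrFun h (1, 1)) (0, 0)
  simp [Matrix.mul_apply, Fintype.sum_prod_type, Fin.sum_univ_two, crossDual] at h1 h2
  -- The combination eliminates the entry from `(1, 1)` to `(0, 0)` of the exchanged pair; the
  -- remaining coefficient is `(1-xz)(1-yw) + (x+y)(z+w) = (1+yz)(1+xw)`.
  linear_combination (1 - y * w) * h1 + (z + w) * h2

/-- The corner entry `y + z` of `cross` is the only nonzero one in its row and in its column, so
there are no boundary terms. The factor is kept because it need not be cancellable. -/
theorem sum_finA_finA_comm (a b : ℤ → R) (x y z w : R) {mu nu : YoungDiagram} {N : ℕ}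
    (hmu : extent mu ≤ N) (hnu : extent nu ≤ N) :
    (y + z) * ∑ lam ∈ box N, finA a b x y mu lam N N * finA a b z w lam nu N N =
      (y + z) * ∑ lam ∈ box N, finA a b z w mu lam N N * finA a b x y lam nu N N := by
  have h := gridProd_intertwine
    (M := fun k => pairMat (vertex x y (a k) (b k) (occ mu k))
      fun s => vertex z w (a k) (b k) s (occ nu k))
    (M' := fun k => pairMat (fun s => vertex x y (a k) (b k) s (occ nu k))
        (vertex z w (a k) (b k) (occ mu k))) (T := cross x y z w)
    (fun k => pairMat_cross _ _ _ _ _ _ _ _) (-(N : ℤ) + 1) (N + N)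
  have h1 := congrFun (congrFun h (0, 0)) (0, 0)
  simp only [Matrix.mul_apply, Fintype.sum_prod_type, Fin.sum_univ_two] at h1
  rw [gridProd_pairMat_window (fun k => vertex x y (a k) (b k) (occ mu k))
      (fun k s => vertex z w (a k) (b k) s (occ nu k)) N fun p hp => ?_,
    gridProd_pairMat_window (fun k s => vertex x y (a k) (b k) s (occ nu k))
      (fun k => vertex z w (a k) (b k) (occ mu k)) N fun p hp => ?_] at h1
  · simp [cross] at h1
    rw [mul_comm (y + z)]
    refine h1.trans ?_
    congr 1
    exact Finset.sum_congr rfl fun _ _ => mul_comm _ _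
  · rw [cnt_eq_of_finA hp, cnt_window hnu]
  · rw [← cnt_eq_of_finA hp, cnt_window hmu]

/-! ### Reversing a dual row -/

/-- A gauge transformation on the horizontal edges: the power of `c` at the right of a column meets
the one at the left of the next, and only the ends survive. No factor is inverted. -/
theorem rowProd_gauge {M M' : ℤ → Matrix (Fin 2) (Fin 2) R} {u v : ℤ → R} {c : R}
    (h : ∀ k l r, M k l r * u k * c ^ (l : ℕ) = M' k l r * v k * c ^ (r : ℕ)) (k : ℤ) (N : ℕ)
    (l r : Fin 2) :
    rowProd M k N l r * (∏ i ∈ Finset.range N, u (k + i)) * c ^ (l : ℕ) =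
      rowProd M' k N l r * (∏ i ∈ Finset.range N, v (k + i)) * c ^ (r : ℕ) := by
  induction N generalizing k l with
  | zero =>
    by_cases hlr : l = r
    · simp [rowProd, hlr]
    · simp [rowProd, hlr]
  | succ N ih =>
    have hp : ∀ f : ℤ → R, ∏ i ∈ Finset.range (N + 1), f (k + i) =
        f k * ∏ i ∈ Finset.range N, f (k + 1 + i) := by
      intro f
      rw [Finset.prod_range_succ', mul_comm]
      push_cast
      simp only [add_assoc, add_comm (1 : ℤ), add_zero]
    simp only [rowProd, Matrix.mul_apply, hp, Finset.sum_mul]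
    refine Finset.sum_congr rfl fun j _ => ?_
    linear_combination
      (rowProd M (k + 1) N j r * ∏ i ∈ Finset.range N, u (k + 1 + i)) * h k l j +
      M' k l j * v k * ih (k + 1) j

/-- The factor between a dual row and the reversed standard row. -/
def gauge (a b : ℤ → R) (N : ℕ) (lam : YoungDiagram) : R :=
  ∏ i ∈ Finset.range (N + N), if occ lam (-(N : ℤ) + 1 + i) = true then
    1 - a (-(N : ℤ) + 1 + i) * b (-(N : ℤ) + 1 + i) else 1

/-- Turning a dual row upside down and exchanging `a` with `b` gives a standard row, except that the
weights `1 - ab` and `x + y` of the turning vertices are swapped. The gauge with `c = x + y`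
compensates for this, and the empty boundary edges leave no power of `c`. -/
theorem finAhat_mul_gauge (a b : ℤ → R) (x y : R) (lam mu : YoungDiagram) (N : ℕ) :
    finAhat a b x y lam mu N N * gauge a b N mu =
      finA b a x y mu lam N N * gauge a b N lam := by
  have := rowProd_gauge (M := fun k => dualVertex x y (a k) (b k) (occ lam k) (occ mu k))
    (M' := fun k => vertex x y (b k) (a k) (occ mu k) (occ lam k))
    (u := fun k => if occ mu k = true then 1 - a k * b k else 1)
    (v := fun k => if occ lam k = true then 1 - a k * b k else 1) (c := x + y) ?_
    (-(N : ℤ) + 1) (N + N) 0 0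
  · simpa [finA, finAhat, gauge] using this
  · intro k l r
    cases occ lam k <;> cases occ mu k <;> fin_cases l <;> fin_cases r <;>
      simp [vertex, dualVertex] <;> ring

/-! ### Reduction of dual coefficients to standard coefficients -/

/-- The denominators of the row operator `𝒜_{a,b}(x,y)` are units. -/
def Admissible (b : ℤ → R) (x y : R) : Prop :=
  (∀ k : ℤ, 1 ≤ k → IsUnit (1 - b k * x)) ∧ ∀ k : ℤ, k ≤ 0 → IsUnit (1 + b k * y)

theorem opA_eq {a b : ℤ → R} {x y : R} (h : Admissible b x y) {mu lam : YoungDiagram} {N : ℕ}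
    (hmu : extent mu ≤ N) (hlam : extent lam ≤ N) :
    opA a b x y mu lam =
      finA a b x y mu lam N N * Ring.inverse (shiftedPow y (dualSeq b) N * shiftedPow x b N) := by
  have hc : cutoff mu lam ≤ N := max_le hmu hlam
  exact (normA_eq_opA a b x y mu lam h.1 h.2 N N hc hc).symm

theorem opAhat_eq {a b : ℤ → R} {x y : R} (h : Admissible a x y) {lam mu : YoungDiagram} {N : ℕ}
    (hlam : extent lam ≤ N) (hmu : extent mu ≤ N) :
    opAhat a b x y lam mu = finAhat a b x y lam mu N N *
      Ring.inverse (shiftedPow y (dualSeq a) N * shiftedPow x a N) := by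
  have hc : cutoff lam mu ≤ N := max_le hlam hmu
  exact (normAhat_eq_opAhat a b x y lam mu h.1 h.2 N N hc hc).symm

theorem isUnit_gauge {a b : ℤ → R} (h : ∀ k, IsUnit (1 - a k * b k)) (N : ℕ)
    (lam : YoungDiagram) : IsUnit (gauge a b N lam) := by
  rw [gauge]
  refine Finset.prod_induction _ IsUnit (fun _ _ => IsUnit.mul) isUnit_one fun i _ => ?_
  split_ifs
  · exact h _
  · exact isUnit_one

/-- The dual row for `(a, b)` and the standard row for `(b, a)` have the same divisor, so the
relation survives the normalization. -/
theorem opAhat_mul_gauge {a b : ℤ → R} {x y : R} (h : Admissible a x y) {lam mu : YoungDiagram}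
    {N : ℕ} (hlam : extent lam ≤ N) (hmu : extent mu ≤ N) :
    opAhat a b x y lam mu * gauge a b N mu = opA b a x y mu lam * gauge a b N lam := by
  rw [opAhat_eq h hlam hmu, opA_eq h hmu hlam]
  linear_combination
    Ring.inverse (shiftedPow y (dualSeq a) N * shiftedPow x a N) *
      finAhat_mul_gauge a b x y lam mu N

/-! ### Decay of the coefficients -/

/-- The power of the ideal counts the occupied horizontal edges. -/
theorem rowProd_mem_pow {J : Ideal R} {M : ℤ → Matrix (Fin 2) (Fin 2) R} {p q : ℤ → Bool}
    (hM : ∀ k l r, M k l r ≠ 0 → (l : ℕ) + (p k).toNat = (q k).toNat + r)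
    (hMJ : ∀ k r, M k 1 r ∈ J) {k : ℤ} {N : ℕ} {l r : Fin 2} {S : Finset ℤ}
    (hS : ∀ t ∈ S, ∃ i j : ℕ, t = k + i ∧ i + j = N ∧ 0 < j ∧ cnt p t j < cnt q t j + r) :
    rowProd M k N l r ∈ J ^ S.card := by
  induction N generalizing k l S with
  | zero =>
    have : S = ∅ := Finset.eq_empty_of_forall_notMem fun t ht => by
      obtain ⟨i, j, -, h1, h2, -⟩ := hS t ht
      omega
    simp [this]
  | succ N ih =>
    have hS' : ∀ t ∈ S.erase k, ∃ i j : ℕ, t = k + 1 + i ∧ i + j = N ∧ 0 < j ∧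
        cnt p t j < cnt q t j + r := by
      intro t ht
      obtain ⟨hne, ht⟩ := Finset.mem_erase.1 ht
      obtain ⟨i, j, h1, h2, h3, h4⟩ := hS t ht
      obtain ⟨i, rfl⟩ : ∃ i', i = i' + 1 := ⟨i - 1, by
        have : i ≠ 0 := by
          rintro rfl
          exact hne (by simpa using h1)
        omega⟩
      exact ⟨i, j, by push_cast at h1; omega, by omega, h3, h4⟩
    by_cases h0 : rowProd M k (N + 1) l r = 0
    · rw [h0]
      exact zero_mem _
    have hcons := rowProd_conserve M p q hM k (N + 1) l r h0
    rw [rowProd, Matrix.mul_apply]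
    refine Ideal.sum_mem _ fun j _ => ?_
    -- If `k ∈ S`, the count of vertical edges from `k` on is unbalanced, so a path must enter
    -- column `k` from the left. The weight of this column then supplies one factor in `J`.
    by_cases hk : k ∈ S
    · obtain ⟨i, j', h1, h2, -, h4⟩ := hS k hk
      have hi : i = 0 := by omega
      have hj' : j' = N + 1 := by omega
      subst hj'
      have hl : l = 1 := by
        have := l.isLt
        refine Fin.ext ?_
        simp only [Fin.val_one]
        omega
      subst hl
      rw [← Finset.card_erase_add_one hk, pow_succ']
      exact Ideal.mul_mem_mul (hMJ k j) (ih hS')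
    · rw [Finset.erase_eq_of_notMem hk] at hS'
      exact Ideal.mul_mem_left _ _ (ih hS')

theorem occ_rowLen (lam : YoungDiagram) : occ lam (lam.rowLen 0) = true :=
  occ_iff.2 ⟨0, by simp⟩

theorem occ_colLen (lam : YoungDiagram) : occ lam (-(lam.colLen 0 : ℤ) + 1) = false := by
  rw [← Bool.not_eq_true, occ_iff]
  rintro ⟨i, hi⟩
  rcases Nat.lt_or_ge i (lam.colLen 0) with h | h
  · have := YoungDiagram.mem_iff_lt_rowLen.1 (YoungDiagram.mem_iff_lt_colLen.2 h)
    omega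
  · rw [rowLen_eq_zero_of_colLen_le h] at hi
    omega

theorem cnt_add (p : ℤ → Bool) (k : ℤ) (m n : ℕ) :
    cnt p k (m + n) = cnt p k m + cnt p (k + m) n := by
  induction m generalizing k with
  | zero => simp [cnt]
  | succ m ih =>
    rw [Nat.add_right_comm, cnt, cnt, ih]
    push_cast
    rw [add_right_comm k, add_assoc k]
    ring_nf

theorem cnt_eq_zero {p : ℤ → Bool} {k : ℤ} {N : ℕ} (h : ∀ t, k ≤ t → t < k + N → p t = false) :
    cnt p k N = 0 := by
  rw [cnt_eq_card, Finset.card_eq_zero, Finset.filter_eq_empty_iff]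
  intro t ht
  rw [Finset.mem_Ico] at ht
  simp [h t ht.1 ht.2]

theorem cnt_pos {p : ℤ → Bool} {k t : ℤ} {N : ℕ} (h1 : k ≤ t) (h2 : t < k + N)
    (h : p t = true) : 0 < cnt p k N := by
  rw [cnt_eq_card, Finset.card_pos]
  exact ⟨t, Finset.mem_filter.2 ⟨Finset.mem_Ico.2 ⟨h1, h2⟩, h⟩⟩

theorem cnt_eq_self {p : ℤ → Bool} {k : ℤ} {N : ℕ} (h : ∀ t, k ≤ t → t < k + N → p t = true) :
    cnt p k N = N := by
  rw [cnt_eq_card, Finset.filter_true_of_mem, Int.card_Ico]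
  · omega
  · intro t ht
    rw [Finset.mem_Ico] at ht
    exact h t ht.1 ht.2

theorem cnt_lt_self {p : ℤ → Bool} {k t : ℤ} {N : ℕ} (h1 : k ≤ t) (h2 : t < k + N)
    (h : p t = false) : cnt p k N < N := by
  have hI : (Finset.Ico k (k + N)).card = N := by
    rw [Int.card_Ico]
    omega
  rw [cnt_eq_card]
  conv_rhs => rw [← hI]
  refine Finset.card_lt_card (Finset.filter_ssubset.2 ⟨t, Finset.mem_Ico.2 ⟨h1, h2⟩, ?_⟩)
  simp [h]

section decay

variable {J : Ideal R} {a b : ℤ → R} {x y : R}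

theorem vertex_mem (ha : ∀ k, a k ∈ J) (hx : x ∈ J) (hy : y ∈ J) (p q : ℤ → Bool) (k : ℤ)
    (r : Fin 2) : vertex x y (a k) (b k) (p k) (q k) 1 r ∈ J := by
  cases p k <;> cases q k <;> fin_cases r <;>
    simp [vertex, Ideal.add_mem, Ideal.sub_mem, ha, hx, hy]

/-- The rightmost particle of `λ` is reached by a path that enters each column from `μ_1 + 1` to
`λ_1` horizontally. -/
theorem opA_mem_pow_rowLen (ha : ∀ k, a k ∈ J) (hx : x ∈ J) (hy : y ∈ J)
    (mu lam : YoungDiagram) : opA a b x y mu lam ∈ J ^ (lam.rowLen 0 - mu.rowLen 0) := by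
  rw [opA, normA, finA]
  refine Ideal.mul_mem_right _ _ ?_
  have hc : mu.rowLen 0 ≤ cutoff mu lam ∧ lam.rowLen 0 ≤ cutoff mu lam ∧
      mu.colLen 0 ≤ cutoff mu lam ∧ lam.colLen 0 ≤ cutoff mu lam := by
    simp [cutoff]
  have hcard : lam.rowLen 0 - mu.rowLen 0 =
      (Finset.Ioc (mu.rowLen 0 : ℤ) (lam.rowLen 0)).card := by
    rw [Int.card_Ioc]
    omega
  rw [hcard]
  refine rowProd_mem_pow (p := occ mu) (q := occ lam) (fun k l r => vertex_conserve _ _ _ _ _ _ l r)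
    (vertex_mem ha hx hy _ _) fun t ht => ?_
  rw [Finset.mem_Ioc] at ht
  refine ⟨(t + cutoff mu lam - 1).toNat, (cutoff mu lam + 1 - t).toNat, by omega, by omega,
    by omega, ?_⟩
  rw [cnt_eq_zero fun s hs _ => occ_right (by omega)]
  exact Nat.add_pos_left (cnt_pos (t := lam.rowLen 0) (by omega) (by omega) (occ_rowLen lam)) _

/-- The mirror argument with holes. Left of the columns in question `μ` is full while `λ` has a
hole; both have `N` particles in the window, so `λ` has more than `μ` from there on. -/
theorem opA_mem_pow_colLen (ha : ∀ k, a k ∈ J) (hx : x ∈ J) (hy : y ∈ J)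
    (mu lam : YoungDiagram) : opA a b x y mu lam ∈ J ^ (lam.colLen 0 - mu.colLen 0) := by
  rw [opA, normA, finA]
  refine Ideal.mul_mem_right _ _ ?_
  have hc : mu.rowLen 0 ≤ cutoff mu lam ∧ lam.rowLen 0 ≤ cutoff mu lam ∧
      mu.colLen 0 ≤ cutoff mu lam ∧ lam.colLen 0 ≤ cutoff mu lam := by
    simp [cutoff]
  have hm : extent mu ≤ cutoff mu lam := le_max_left _ _
  have hl : extent lam ≤ cutoff mu lam := le_max_right _ _
  have hcard : lam.colLen 0 - mu.colLen 0 =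
      (Finset.Ioc (-(lam.colLen 0 : ℤ) + 1) (-(mu.colLen 0 : ℤ) + 1)).card := by
    rw [Int.card_Ioc]
    omega
  rw [hcard]
  refine rowProd_mem_pow (p := occ mu) (q := occ lam) (fun k l r => vertex_conserve _ _ _ _ _ _ l r)
    (vertex_mem ha hx hy _ _) fun t ht => ?_
  rw [Finset.mem_Ioc] at ht
  obtain ⟨i, hi⟩ : ∃ i : ℕ, t = -(cutoff mu lam : ℤ) + 1 + i :=
    ⟨(t + cutoff mu lam - 1).toNat, by omega⟩
  obtain ⟨j, hj⟩ : ∃ j : ℕ, i + j = cutoff mu lam + cutoff mu lam :=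
    ⟨(cutoff mu lam + 1 - t).toNat, by omega⟩
  refine ⟨i, j, hi, hj, by omega, ?_⟩
  have h1 := cnt_window hm
  have h2 := cnt_window hl
  rw [← hj, cnt_add, ← hi] at h1 h2
  have h3 : cnt (occ mu) (-(cutoff mu lam : ℤ) + 1) i = i :=
    cnt_eq_self fun s _ hs => occ_left (by omega)
  have h4 : cnt (occ lam) (-(cutoff mu lam : ℤ) + 1) i < i :=
    cnt_lt_self (t := -(lam.colLen 0 : ℤ) + 1) (by omega) (by omega) (occ_colLen lam)
  omega

theorem opA_mem_pow (ha : ∀ k, a k ∈ J) (hx : x ∈ J) (hy : y ∈ J) (mu lam : YoungDiagram) :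
    opA a b x y mu lam ∈ J ^ (extent lam - extent mu) := by
  rcases le_total (lam.rowLen 0) (lam.colLen 0) with h | h
  · refine Ideal.pow_le_pow_right ?_ (opA_mem_pow_colLen ha hx hy mu lam)
    simp only [extent]
    omega
  · refine Ideal.pow_le_pow_right ?_ (opA_mem_pow_rowLen ha hx hy mu lam)
    simp only [extent]
    omega

theorem admissible_of_mem (hJ : ∀ p ∈ J, IsUnit (1 - p)) (hb : ∀ k, b k ∈ J) (x y : R) :
    Admissible b x y :=
  ⟨fun k _ => hJ _ (J.mul_mem_right _ (hb k)), fun k _ => by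
    simpa using hJ _ (J.neg_mem (J.mul_mem_right y (hb k)))⟩

/-- Both gauge factors can be ignored: the one on the dual side is a unit, and the other only
multiplies an element of the ideal. This reduces to the standard row with `a` and `b` exchanged. -/
theorem opAhat_mem_pow (hJ : ∀ p ∈ J, IsUnit (1 - p)) (ha : ∀ k, a k ∈ J) (hb : ∀ k, b k ∈ J)
    (hx : x ∈ J) (hy : y ∈ J) (lam mu : YoungDiagram) :
    opAhat a b x y lam mu ∈ J ^ (extent lam - extent mu) := by
  have h := opAhat_mul_gauge (a := a) (b := b) (admissible_of_mem hJ ha x y)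
    (le_max_left (extent lam) (extent mu)) (le_max_right (extent lam) (extent mu))
  have hu := isUnit_gauge (fun k => hJ _ (J.mul_mem_right (b k) (ha k)))
    (max (extent lam) (extent mu)) mu
  rw [← Ideal.mul_unit_mem_iff_mem _ hu, h]
  exact Ideal.mul_mem_right _ _ (opA_mem_pow hb hx hy mu lam)

/-! ### The exchange of two infinite rows, modulo powers of an ideal -/

variable {z w : R} {mu nu : YoungDiagram}

/-- With empty outer edges a pair of horizontal edges can be absorbed into an occupied middle edge,
but cannot be created. -/
theorem upperLower_right {k : ℤ} (hmu : (mu.rowLen 0 : ℤ) < k) (hnu : (nu.rowLen 0 : ℤ) < k)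
    (i : Fin 2 × Fin 2) (hi : i ≠ (1, 1)) : upperLower a b x y z w mu nu k i (1, 1) = 0 := by
  obtain ⟨i, j⟩ := i
  rw [upperLower, occ_right hmu, occ_right hnu]
  fin_cases i <;> fin_cases j <;> simp_all [pairMat, vertex, dualVertex]

/-- With occupied outer edges a pair of horizontal edges can be created by emptying the middle edge,
but cannot disappear. -/
theorem upperLower_left {k : ℤ} (hmu : k ≤ -(mu.colLen 0 : ℤ)) (hnu : k ≤ -(nu.colLen 0 : ℤ))
    (i : Fin 2 × Fin 2) (hi : i ≠ (1, 1)) : upperLower a b x y z w mu nu k (1, 1) i = 0 := by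
  obtain ⟨i, j⟩ := i
  rw [upperLower, occ_left hmu, occ_left hnu]
  fin_cases i <;> fin_cases j <;> simp_all [pairMat, vertex, dualVertex]

theorem upperLower_mem (ha : ∀ k, a k ∈ J) (hx : x ∈ J) (hy : y ∈ J) (k : ℤ) :
    upperLower a b x y z w mu nu k (1, 1) (1, 1) ∈ J := by
  have h := fun p q => vertex_mem (b := b) ha hx hy p q k 1
  simp only [upperLower, pairMat, Matrix.add_apply, Matrix.kroneckerMap_apply]
  exact J.add_mem (J.mul_mem_right _ (h (occ mu) fun _ => false))
    (J.mul_mem_right _ (h (occ mu) fun _ => true))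

theorem prod_range_mem_pow {f : ℕ → R} (hf : ∀ i, f i ∈ J) (n : ℕ) :
    ∏ i ∈ Finset.range n, f i ∈ J ^ n := by
  induction n with
  | zero => simp
  | succ n ih =>
    rw [Finset.prod_range_succ, pow_succ]
    exact Ideal.mul_mem_mul ih (hf n)

/-- To end in the state `(1, 1)`, the row must be in this state throughout its last `d` columns,
which lie beyond `μ` and `ν`. -/
theorem gridProd_upperLower_right (ha : ∀ k, a k ∈ J) (hx : x ∈ J) (hy : y ∈ J) {n d : ℕ}
    (hmu : extent mu ≤ n) (hnu : extent nu ≤ n) (i : Fin 2 × Fin 2) :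
    gridProd (upperLower a b x y z w mu nu) (-((n + d : ℕ) : ℤ) + 1) (n + d + (n + d)) i (1, 1) ∈
      J ^ d := by
  obtain ⟨h1, h2⟩ := max_le_iff.1 hmu
  obtain ⟨h3, h4⟩ := max_le_iff.1 hnu
  rw [← add_assoc, gridProd_add, Matrix.mul_apply]
  refine Ideal.sum_mem _ fun j _ => Ideal.mul_mem_left _ _ ?_
  rw [gridProd_apply_right fun t ht => upperLower_right (by push_cast at ht; omega)
    (by push_cast at ht; omega)]
  split_ifs
  · exact prod_range_mem_pow (fun _ => upperLower_mem ha hx hy _) d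
  · exact zero_mem _

theorem gridProd_upperLower_left (ha : ∀ k, a k ∈ J) (hx : x ∈ J) (hy : y ∈ J) {n d : ℕ}
    (hmu : extent mu ≤ n) (hnu : extent nu ≤ n) (i : Fin 2 × Fin 2) :
    gridProd (upperLower a b x y z w mu nu) (-((n + d : ℕ) : ℤ) + 1) (n + d + (n + d)) (1, 1) i ∈
      J ^ d := by
  obtain ⟨h1, h2⟩ := max_le_iff.1 hmu
  obtain ⟨h3, h4⟩ := max_le_iff.1 hnu
  rw [show n + d + (n + d) = d + (n + (n + d)) by ring, gridProd_add, Matrix.mul_apply]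
  refine Ideal.sum_mem _ fun j _ => Ideal.mul_mem_right _ _ ?_
  rw [gridProd_apply_left fun t ht => upperLower_left (by push_cast at ht; omega)
    (by push_cast at ht; omega)]
  split_ifs
  · exact prod_range_mem_pow (fun _ => upperLower_mem ha hx hy _) d
  · exact zero_mem _

/-- The difference of the two sides consists of the boundary terms of the finite exchange relation,
each of which carries `d` factors in `J`. -/
theorem exchange_mem_pow (hJ : ∀ p ∈ J, IsUnit (1 - p)) (ha : ∀ k, a k ∈ J) (hb : ∀ k, b k ∈ J)
    (hx : x ∈ J) (hy : y ∈ J) {n d : ℕ}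
    (hmu : extent mu ≤ n) (hnu : extent nu ≤ n) :
    (1 - x * z) * (1 - y * w) *
        ∑ lam ∈ box (n + d), opA a b x y mu lam * opAhat a b z w lam nu -
      (1 + y * z) * (1 + x * w) *
        ∑ rho ∈ box (n + d), opAhat a b z w mu rho * opA a b x y rho nu ∈ J ^ d := by
  have hmu' : extent mu ≤ n + d := hmu.trans (Nat.le_add_right _ _)
  have hnu' : extent nu ≤ n + d := hnu.trans (Nat.le_add_right _ _)
  have hA := admissible_of_mem hJ hb x y
  have hAhat := admissible_of_mem hJ ha z w
  -- All partitions in the box are treated in one window, so every term on either side has this same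
  -- normalization.
  set c := Ring.inverse (shiftedPow y (dualSeq b) (n + d) * shiftedPow x b (n + d)) *
    Ring.inverse (shiftedPow w (dualSeq a) (n + d) * shiftedPow z a (n + d)) with hc
  have h1 : ∑ lam ∈ box (n + d), opA a b x y mu lam * opAhat a b z w lam nu =
      (∑ lam ∈ box (n + d), finA a b x y mu lam (n + d) (n + d) *
        finAhat a b z w lam nu (n + d) (n + d)) * c := by
    rw [Finset.sum_mul]
    refine Finset.sum_congr rfl fun lam hlam => ?_
    rw [mem_box] at hlam
    rw [opA_eq hA hmu' hlam, opAhat_eq hAhat hlam hnu', hc]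
    ring
  have h2 : ∑ rho ∈ box (n + d), opAhat a b z w mu rho * opA a b x y rho nu =
      (∑ rho ∈ box (n + d), finAhat a b z w mu rho (n + d) (n + d) *
        finA a b x y rho nu (n + d) (n + d)) * c := by
    rw [Finset.sum_mul]
    refine Finset.sum_congr rfl fun rho hrho => ?_
    rw [mem_box] at hrho
    rw [opA_eq hA hrho hnu', opAhat_eq hAhat hmu' hrho, hc]
    ring
  rw [h1, h2]
  have h3 := sum_finA_finAhat_exchange a b x y z w hmu' hnu'
  have h4 := gridProd_upperLower_right (b := b) (z := z) (w := w) ha hx hy (d := d) hmu hnu (0, 0)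
  have h5 := gridProd_upperLower_left (b := b) (z := z) (w := w) ha hx hy (d := d) hmu hnu (0, 0)
  have h6 := gridProd_upperLower_left (b := b) (z := z) (w := w) ha hx hy (d := d) hmu hnu (1, 1)
  rw [← mul_assoc _ _ c, ← mul_assoc _ _ c, ← h3, ← sub_mul]
  refine Ideal.mul_mem_right _ _ ?_
  rw [sub_add_cancel_left]
  exact neg_mem (add_mem (add_mem (Ideal.mul_mem_left _ _ h4) (Ideal.mul_mem_left _ _ h5))
    (Ideal.mul_mem_left _ _ h6))

end decay

/-! ### The incidence algebra of Young's lattice -/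

instance : LocallyFiniteOrder YoungDiagram :=
  LocallyFiniteOrder.ofFiniteIcc fun _ b => (finite_le b).subset fun _ h => h.2

instance : DecidableEq YoungDiagram := Classical.decEq _

/-- The operator `𝒜_{a,b}(x,y)` as an element of the incidence algebra. -/
def incA (a b : ℤ → R) (x y : R) : IncidenceAlgebra R YoungDiagram :=
  ⟨opA a b x y, fun _ _ h => not_not.1 (mt le_of_opA_ne_zero h)⟩

/-- The transpose of the operator `𝒜̂_{a,b}(x,y)` as an element of the incidence algebra. -/
def incAhat (a b : ℤ → R) (x y : R) : IncidenceAlgebra R YoungDiagram :=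
  ⟨fun mu lam => opAhat a b x y lam mu, fun _ _ h => not_not.1 (mt le_of_opAhat_ne_zero h)⟩

@[simp]
theorem incA_apply (a b : ℤ → R) (x y : R) (mu lam : YoungDiagram) :
    incA a b x y mu lam = opA a b x y mu lam := rfl

@[simp]
theorem incAhat_apply (a b : ℤ → R) (x y : R) (mu lam : YoungDiagram) :
    incAhat a b x y mu lam = opAhat a b x y lam mu := rfl

theorem mul_apply_eq_finsum (P Q : IncidenceAlgebra R YoungDiagram) (mu lam : YoungDiagram) :
    (P * Q) mu lam = ∑ᶠ kap, P mu kap * Q kap lam := by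
  rw [IncidenceAlgebra.mul_apply, finsum_eq_sum_of_support_subset]
  intro kap h
  rw [Finset.coe_Icc]
  exact ⟨IncidenceAlgebra.le_of_ne_zero (left_ne_zero_of_mul h),
    IncidenceAlgebra.le_of_ne_zero (right_ne_zero_of_mul h)⟩

theorem compCoeff_eq_prod {n : ℕ} (T : Fin n → IncidenceAlgebra R YoungDiagram)
    (mu lam : YoungDiagram) :
    compCoeff (fun i => T i) mu lam = ((List.finRange n).map T).prod mu lam := by
  induction n generalizing mu with
  | zero => simp [compCoeff]
  | succ n ih =>
    rw [compCoeff, List.finRange_succ, List.map_cons, List.prod_cons, mul_apply_eq_finsum]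
    refine finsum_congr fun kap => ?_
    rw [ih fun i => T i.succ, List.map_map]
    rfl

/-- The incidence algebra elements are transposed, which reverses the order of composition. -/
theorem compCoeff_eq_prod_reverse {n : ℕ} (T : Fin n → IncidenceAlgebra R YoungDiagram)
    (lam mu : YoungDiagram) :
    compCoeff (fun i kap kap' => T i kap' kap) lam mu =
      ((List.finRange n).reverse.map T).prod mu lam := by
  induction n generalizing lam with
  | zero => simp [compCoeff, eq_comm]
  | succ n ih =>
    rw [compCoeff, List.finRange_succ, List.reverse_cons, List.map_append, List.prod_append,
      mul_apply_eq_finsum]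
    refine finsum_congr fun kap => ?_
    rw [ih fun i => T i.succ, ← List.map_reverse, List.map_map, mul_comm]
    simp
    rfl

theorem schur_eq {n : ℕ} (a b : ℤ → R) (x y : Fin n → R) (lam mu : YoungDiagram) :
    schur a b x y lam mu =
      ((List.finRange n).map fun i => incA a b (x i) (y i)).prod mu lam :=
  compCoeff_eq_prod (fun i => incA a b (x i) (y i)) mu lam

theorem dualSchur_eq {n : ℕ} (a b : ℤ → R) (x y : Fin n → R) (lam mu : YoungDiagram) :
    dualSchur a b x y lam mu =
      ((List.finRange n).reverse.map fun i => incAhat a b (x i) (y i)).prod mu lam :=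
  compCoeff_eq_prod_reverse (fun i => incAhat a b (x i) (y i)) lam mu

/-- Triangularity confines the support to partitions below both `μ` and `ν`, so the index set can be
chosen for convenience. -/
theorem sum_Icc_bot_inf (P D : IncidenceAlgebra R YoungDiagram) {mu nu : YoungDiagram}
    {S : Finset YoungDiagram} (hS : ∀ rho, rho ≤ mu → rho ≤ nu → rho ∈ S) :
    ∑ rho ∈ Finset.Icc ⊥ (mu ⊓ nu), D rho mu * P rho nu = ∑ rho ∈ S, D rho mu * P rho nu := by
  refine Finset.sum_subset (fun rho h => ?_) fun rho _ h => ?_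
  · obtain ⟨-, h⟩ := Finset.mem_Icc.1 h
    exact hS _ (h.trans inf_le_left) (h.trans inf_le_right)
  · by_contra hne
    exact h (Finset.mem_Icc.2 ⟨bot_le, le_inf
      (IncidenceAlgebra.le_of_ne_zero (left_ne_zero_of_mul hne))
      (IncidenceAlgebra.le_of_ne_zero (right_ne_zero_of_mul hne))⟩)

/-! ### Operators with decaying coefficients -/

/-- The coefficients of `P` decay with respect to the powers of the ideal `J`. -/
def Decays (J : Ideal R) (P : IncidenceAlgebra R YoungDiagram) : Prop :=
  ∀ mu lam, P mu lam ∈ J ^ (extent lam - extent mu)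

theorem Decays.one (J : Ideal R) : Decays J 1 := by
  intro mu lam
  rw [IncidenceAlgebra.one_apply]
  split_ifs with h
  · simp [h]
  · exact zero_mem _

theorem Decays.mul {J : Ideal R} {P Q : IncidenceAlgebra R YoungDiagram} (hP : Decays J P)
    (hQ : Decays J Q) : Decays J (P * Q) := by
  intro mu lam
  rw [IncidenceAlgebra.mul_apply]
  refine Ideal.sum_mem _ fun kap _ => ?_
  -- Truncated differences satisfy the triangle inequality.
  refine Ideal.pow_le_pow_right (n := extent kap - extent mu + (extent lam - extent kap))
    (by omega) ?_
  rw [pow_add]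
  exact Ideal.mul_mem_mul (hP _ _) (hQ _ _)

theorem Decays.list_prod {ι : Type*} {J : Ideal R} {A : ι → IncidenceAlgebra R YoungDiagram}
    (hA : ∀ i, Decays J (A i)) (L : List ι) : Decays J (L.map A).prod := by
  induction L with
  | nil => exact Decays.one J
  | cons i L ih =>
    rw [List.map_cons, List.prod_cons]
    exact (hA i).mul ih

/-! ### The identity in rings of formal power series -/

section powerSeries

variable {σ : Type*}

/-- The ideal of the power series without constant term. -/
abbrev augIdeal (σ : Type*) : Ideal (MvPowerSeries σ ℤ) :=
  RingHom.ker (MvPowerSeries.constantCoeff (σ := σ) (R := ℤ))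

theorem isUnit_one_sub_of_mem_augIdeal {p : MvPowerSeries σ ℤ} (hp : p ∈ augIdeal σ) :
    IsUnit (1 - p) := by
  rw [MvPowerSeries.isUnit_iff_constantCoeff, map_sub, map_one, RingHom.mem_ker.1 hp, sub_zero]
  exact isUnit_one

theorem le_order_of_mem_augIdeal_pow {n : ℕ} {p : MvPowerSeries σ ℤ} (hp : p ∈ augIdeal σ ^ n) :
    (n : ℕ∞) ≤ p.order := by
  induction n generalizing p with
  | zero => simp
  | succ n ih =>
    rw [pow_succ] at hp
    refine Submodule.mul_induction_on hp (fun q hq r hr => ?_) fun q r hq hr => ?_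
    · refine le_trans ?_ MvPowerSeries.le_order_mul
      push_cast
      exact add_le_add (ih hq)
        (MvPowerSeries.one_le_order_iff_constCoeff_eq_zero.2 (RingHom.mem_ker.1 hr))
    · exact (le_min hq hr).trans MvPowerSeries.min_order_le_add

theorem coeff_eq_zero_of_mem_augIdeal_pow {n : ℕ} {p : MvPowerSeries σ ℤ}
    (hp : p ∈ augIdeal σ ^ n) {d : σ →₀ ℕ} (hd : d.degree < n) : MvPowerSeries.coeff d p = 0 :=
  MvPowerSeries.coeff_of_lt_order
    (lt_of_lt_of_le (by exact_mod_cast hd) (le_order_of_mem_augIdeal_pow hp))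

theorem summable_of_mem_augIdeal_pow {ι : Type*} {f : ι → MvPowerSeries σ ℤ} {e : ι → ℕ}
    (hf : ∀ i, f i ∈ augIdeal σ ^ e i) (he : ∀ d, {i | f i ≠ 0 ∧ e i ≤ d}.Finite) :
    Summable f := by
  rw [MvPowerSeries.WithPiTopology.summable_iff_summable_coeff]
  intro d
  refine summable_of_hasFiniteSupport ((he d.degree).subset fun i hi => ⟨?_, ?_⟩)
  · intro h0
    exact hi (by simp [h0])
  · by_contra hlt
    exact hi (coeff_eq_zero_of_mem_augIdeal_pow (hf i) (not_le.1 hlt))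

/-- Each coefficient involves only finitely many `λ`, since an element of `J^k` has no terms of
degree below `k`; its value is read off from a large box. -/
theorem hasSum_of_box {f : YoungDiagram → MvPowerSeries σ ℤ} {s : MvPowerSeries σ ℤ} {n : ℕ}
    (hf : ∀ lam, f lam ∈ augIdeal σ ^ (extent lam - n))
    (h : ∀ d, ∑ lam ∈ box (n + d), f lam - s ∈ augIdeal σ ^ d) : HasSum f s := by
  rw [MvPowerSeries.WithPiTopology.hasSum_iff_hasSum_coeff]
  intro e
  -- One more than the degree, because only coefficients of degree strictly below the exponent
  -- vanish.
  have h1 := coeff_eq_zero_of_mem_augIdeal_pow (h (e.degree + 1)) (Nat.lt_succ_self _)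
  rw [map_sub, map_sum, sub_eq_zero] at h1
  rw [← h1]
  refine hasSum_sum_of_ne_finset_zero fun lam hlam => ?_
  rw [mem_box, not_le] at hlam
  exact coeff_eq_zero_of_mem_augIdeal_pow (hf lam) (by omega)

/-- The skew Cauchy identity for the operators `P` and `Dᵀ`, with the factor `F`. -/
def CauchyPair (P D : IncidenceAlgebra (MvPowerSeries σ ℤ) YoungDiagram)
    (F : MvPowerSeries σ ℤ) : Prop :=
  ∀ mu nu, HasSum (fun lam => P mu lam * D nu lam)
    (F * ∑ rho ∈ Finset.Icc ⊥ (mu ⊓ nu), D rho mu * P rho nu)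

variable {P Q D : IncidenceAlgebra (MvPowerSeries σ ℤ) YoungDiagram} {F G : MvPowerSeries σ ℤ}

theorem CauchyPair.symm (h : CauchyPair P D F) : CauchyPair D P F := by
  intro mu nu
  have := h nu mu
  rw [inf_comm]
  simpa only [mul_comm (P _ _)] using this

theorem CauchyPair.one_left (D : IncidenceAlgebra (MvPowerSeries σ ℤ) YoungDiagram) :
    CauchyPair 1 D 1 := by
  intro mu nu
  have h : ∑ rho ∈ Finset.Icc ⊥ (mu ⊓ nu), D rho mu * (1 : IncidenceAlgebra _ _) rho nu =
      D nu mu := by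
    rw [sum_Icc_bot_inf 1 D (S := {nu} ∪ Finset.Icc ⊥ nu) fun rho _ h =>
      Finset.mem_union_right _ (Finset.mem_Icc.2 ⟨bot_le, h⟩), Finset.sum_eq_single nu]
    · simp
    · intro rho _ hne
      simp [hne]
    · simp
  rw [h, one_mul]
  have := hasSum_single (f := fun lam => (1 : IncidenceAlgebra (MvPowerSeries σ ℤ) _) mu lam *
    D nu lam) mu fun lam hne => by simp [hne.symm]
  simpa using this

/-- The double series over `(κ, λ)` is summed in two ways: over `κ` first it gives the coefficients
of `P * Q`; over `λ` first it allows `D` to be exchanged with `Q`, and then with `P`. -/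
theorem CauchyPair.mul_left (hP : CauchyPair P D F) (hQ : CauchyPair Q D G)
    (dP : Decays (augIdeal σ) P) (dQ : Decays (augIdeal σ) Q) : CauchyPair (P * Q) D (F * G) := by
  intro mu nu
  set g : YoungDiagram × YoungDiagram → MvPowerSeries σ ℤ :=
    fun p => P mu p.1 * Q p.1 p.2 * D nu p.2 with hg
  have hsum : Summable g := by
    refine summable_of_mem_augIdeal_pow (e := fun p => extent p.2 - extent mu) (fun p => ?_)
      fun d => ?_
    · refine Ideal.mul_mem_right _ _ (Ideal.pow_le_pow_right
        (n := extent p.1 - extent mu + (extent p.2 - extent p.1)) (by omega) ?_)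
      rw [pow_add]
      exact Ideal.mul_mem_mul (dP _ _) (dQ _ _)
    · refine ((finite_extent_le (extent mu + d)).prod (finite_extent_le (extent mu + d))).subset ?_
      rintro ⟨kap, lam⟩ ⟨h1, h2⟩
      -- A nonzero term has `κ ⊆ λ`, so a bound on `λ` also bounds `κ`.
      have h3 := extent_mono (IncidenceAlgebra.le_of_ne_zero
        (right_ne_zero_of_mul (left_ne_zero_of_mul h1)))
      simp only at h2 h3
      exact ⟨show extent kap ≤ _ by omega, show extent lam ≤ _ by omega⟩
  obtain ⟨s, hs⟩ := hsum
  have h1 : HasSum (fun lam => (P * Q) mu lam * D nu lam) s := by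
    refine ((Equiv.prodComm _ _).hasSum_iff.2 hs).prod_fiberwise fun lam => ?_
    rw [IncidenceAlgebra.mul_apply, Finset.sum_mul]
    refine hasSum_sum_of_ne_finset_zero fun kap hk => ?_
    by_contra hne
    refine hk (Finset.mem_Icc.2 ⟨?_, ?_⟩)
    · exact IncidenceAlgebra.le_of_ne_zero (left_ne_zero_of_mul (left_ne_zero_of_mul hne))
    · exact IncidenceAlgebra.le_of_ne_zero (right_ne_zero_of_mul (left_ne_zero_of_mul hne))
  have h2 : HasSum (fun kap => P mu kap *
      (G * ∑ rho ∈ Finset.Icc ⊥ nu, D rho kap * Q rho nu)) s := by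
    refine hs.prod_fiberwise fun kap => ?_
    rw [← sum_Icc_bot_inf Q D fun rho _ h => Finset.mem_Icc.2 ⟨bot_le, h⟩]
    simpa only [hg, mul_assoc] using (hQ kap nu).mul_left (P mu kap)
  have h3 : HasSum (fun kap => P mu kap *
      (G * ∑ rho ∈ Finset.Icc ⊥ nu, D rho kap * Q rho nu))
      (∑ rho ∈ Finset.Icc ⊥ nu, G * Q rho nu *
        (F * ∑ tau ∈ Finset.Icc ⊥ (mu ⊓ rho), D tau mu * P tau rho)) := by
    have := hasSum_sum fun rho (_ : rho ∈ Finset.Icc ⊥ nu) => (hP mu rho).mul_left (G * Q rho nu)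
    refine this.congr_fun fun kap => ?_
    rw [Finset.mul_sum, Finset.mul_sum]
    exact Finset.sum_congr rfl fun rho _ => by ring
  rw [h2.unique h3] at h1
  convert! h1 using 1
  rw [sum_Icc_bot_inf (P * Q) D (S := Finset.Icc ⊥ nu)
    fun rho _ h => Finset.mem_Icc.2 ⟨bot_le, h⟩]
  have h4 : ∀ rho ∈ Finset.Icc ⊥ nu, G * Q rho nu *
      (F * ∑ tau ∈ Finset.Icc ⊥ (mu ⊓ rho), D tau mu * P tau rho) =
      ∑ tau ∈ Finset.Icc ⊥ nu, F * G * (D tau mu * (P tau rho * Q rho nu)) := by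
    intro rho hrho
    rw [sum_Icc_bot_inf P D (S := Finset.Icc ⊥ nu) fun tau _ h =>
      Finset.mem_Icc.2 ⟨bot_le, h.trans (Finset.mem_Icc.1 hrho).2⟩, Finset.mul_sum, Finset.mul_sum]
    exact Finset.sum_congr rfl fun tau _ => by ring
  rw [Finset.sum_congr rfl h4, Finset.sum_comm, Finset.mul_sum]
  refine Finset.sum_congr rfl fun tau _ => ?_
  rw [← Finset.mul_sum, ← Finset.mul_sum, IncidenceAlgebra.mul_apply]
  congr 2
  refine Finset.sum_subset (fun rho h => ?_) fun rho _ h => ?_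
  · exact Finset.mem_Icc.2 ⟨bot_le, (Finset.mem_Icc.1 h).2⟩
  · by_contra hne
    exact h (Finset.mem_Icc.2 ⟨IncidenceAlgebra.le_of_ne_zero (left_ne_zero_of_mul hne),
      IncidenceAlgebra.le_of_ne_zero (right_ne_zero_of_mul hne)⟩)

theorem CauchyPair.list_left {ι : Type*}
    {A : ι → IncidenceAlgebra (MvPowerSeries σ ℤ) YoungDiagram} {f : ι → MvPowerSeries σ ℤ}
    (h : ∀ i, CauchyPair (A i) D (f i)) (hA : ∀ i, Decays (augIdeal σ) (A i)) (L : List ι) :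
    CauchyPair (L.map A).prod D (L.map f).prod := by
  induction L with
  | nil => exact CauchyPair.one_left D
  | cons i L ih =>
    simp only [List.map_cons, List.prod_cons]
    exact (h i).mul_left ih (hA i) (Decays.list_prod hA L)

theorem cauchyPair_incA_incAhat {a b : ℤ → MvPowerSeries σ ℤ} {x y z w : MvPowerSeries σ ℤ}
    (ha : ∀ k, a k ∈ augIdeal σ) (hb : ∀ k, b k ∈ augIdeal σ) (hx : x ∈ augIdeal σ)
    (hy : y ∈ augIdeal σ) :
    CauchyPair (incA a b x y) (incAhat a b z w)
      (((1 + y * z) * Ring.inverse (1 - x * z)) * ((1 + x * w) * Ring.inverse (1 - y * w))) := by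
  intro mu nu
  set n := max (extent mu) (extent nu) with hn
  have hmu : extent mu ≤ n := le_max_left _ _
  have hnu : extent nu ≤ n := le_max_right _ _
  refine hasSum_of_box (n := n) (fun lam => ?_) fun d => ?_
  · exact Ideal.mul_mem_right _ _ (Ideal.pow_le_pow_right (by omega)
      (opA_mem_pow ha hx hy mu lam))
  · have h := exchange_mem_pow (z := z) (w := w) (d := d)
      (fun p hp => isUnit_one_sub_of_mem_augIdeal hp) ha hb hx hy hmu hnu
    have hu : IsUnit ((1 - x * z) * (1 - y * w)) :=
      (isUnit_one_sub_of_mem_augIdeal (Ideal.mul_mem_right _ _ hx)).mul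
        (isUnit_one_sub_of_mem_augIdeal (Ideal.mul_mem_right _ _ hy))
    -- Clearing the denominators of the factor reduces the claim to the exchange modulo `J^d`.
    rw [← Ideal.unit_mul_mem_iff_mem _ hu]
    convert h using 1
    rw [sum_Icc_bot_inf (incA a b x y) (incAhat a b z w) (S := box (n + d)) fun rho h _ =>
      mem_box.2 ((extent_mono h).trans (hmu.trans (Nat.le_add_right _ _)))]
    simp only [incA_apply, incAhat_apply]
    rw [mul_sub]
    congr 1
    have h1 := Ring.mul_inverse_cancel _ (isUnit_of_mul_isUnit_left hu)
    have h2 := Ring.mul_inverse_cancel _ (isUnit_of_mul_isUnit_right hu)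
    linear_combination (1 + y * z) * (1 + x * w) *
      (∑ rho ∈ box (n + d), opAhat a b z w mu rho * opA a b x y rho nu) *
      ((1 - y * w) * Ring.inverse (1 - y * w) * h1 + h2)

/-- The skew Cauchy identity for power series without constant term. -/
theorem hasSum_schur_mul_dualSchur {n m : ℕ} {a b : ℤ → MvPowerSeries σ ℤ}
    {x y : Fin n → MvPowerSeries σ ℤ} {z w : Fin m → MvPowerSeries σ ℤ}
    (ha : ∀ k, a k ∈ augIdeal σ) (hb : ∀ k, b k ∈ augIdeal σ) (hx : ∀ i, x i ∈ augIdeal σ)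
    (hy : ∀ i, y i ∈ augIdeal σ) (hz : ∀ j, z j ∈ augIdeal σ) (hw : ∀ j, w j ∈ augIdeal σ)
    (mu nu : YoungDiagram) :
    HasSum (fun lam => schur a b x y lam mu * dualSchur a b z w lam nu)
      (cauchyFactor x y z w * ∑ᶠ rho, dualSchur a b z w mu rho * schur a b x y nu rho) := by
  have h1 : ∀ j, CauchyPair ((List.finRange n).map fun i => incA a b (x i) (y i)).prod
      (incAhat a b (z j) (w j)) _ := fun j => CauchyPair.list_left
    (fun i => cauchyPair_incA_incAhat (z := z j) (w := w j) ha hb (hx i) (hy i))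
    (fun i => opA_mem_pow ha (hx i) (hy i)) _
  -- The relation is symmetric in the two operators, so the dual rows are accumulated by the same
  -- induction.
  have h2 := (CauchyPair.list_left (fun j => (h1 j).symm)
    (fun j mu lam => opAhat_mem_pow (fun p hp => isUnit_one_sub_of_mem_augIdeal hp) ha hb (hz j)
      (hw j) lam mu) (List.finRange m).reverse).symm mu nu
  simp only [schur_eq, dualSchur_eq]
  convert h2 using 2
  · rw [List.map_reverse, List.prod_reverse, cauchyFactor, Finset.prod_comm, Fin.prod_univ_def]
    simp only [Fin.prod_univ_def]
  · refine finsum_eq_sum_of_support_subset _ fun rho h => ?_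
    rw [Finset.coe_Icc]
    exact ⟨bot_le, le_inf (IncidenceAlgebra.le_of_ne_zero (left_ne_zero_of_mul h))
      (IncidenceAlgebra.le_of_ne_zero (right_ne_zero_of_mul h))⟩

end powerSeries

/-! ### The row operators commute -/

theorem mul_apply_eq_sum_box {P Q : IncidenceAlgebra R YoungDiagram} {mu nu : YoungDiagram} {N : ℕ}
    (hnu : extent nu ≤ N) : (P * Q) mu nu = ∑ kap ∈ box N, P mu kap * Q kap nu := by
  rw [IncidenceAlgebra.mul_apply]
  refine Finset.sum_subset (fun kap h => ?_) fun kap _ h => ?_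
  · exact mem_box.2 ((extent_mono (Finset.mem_Icc.1 h).2).trans hnu)
  · by_contra hne
    exact h (Finset.mem_Icc.2 ⟨IncidenceAlgebra.le_of_ne_zero (left_ne_zero_of_mul hne),
      IncidenceAlgebra.le_of_ne_zero (right_ne_zero_of_mul hne)⟩)

/-- The finite commutation relation carries the factor `y + z`, which can be cancelled here; the
normalizations of the two rows simply change places. -/
theorem commute_incA [NoZeroDivisors R] {a b : ℤ → R} {x y z w : R} (h : Admissible b x y)
    (h' : Admissible b z w) (hyz : y + z ≠ 0) : Commute (incA a b x y) (incA a b z w) := by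
  refine IncidenceAlgebra.ext fun mu nu hle => ?_
  set N := extent nu
  have hmu : extent mu ≤ N := extent_mono hle
  have key : ∀ {x y z w : R}, Admissible b x y → Admissible b z w →
      (incA a b x y * incA a b z w) mu nu =
        (∑ lam ∈ box N, finA a b x y mu lam N N * finA a b z w lam nu N N) *
        (Ring.inverse (shiftedPow y (dualSeq b) N * shiftedPow x b N) *
          Ring.inverse (shiftedPow w (dualSeq b) N * shiftedPow z b N)) := by
    intro x y z w h h'
    rw [mul_apply_eq_sum_box (le_refl N), Finset.sum_mul]
    refine Finset.sum_congr rfl fun lam hlam => ?_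
    rw [mem_box] at hlam
    rw [incA_apply, incA_apply, opA_eq h hmu hlam, opA_eq h' hlam (le_refl N)]
    ring
  rw [key h h', key h' h, mul_left_cancel₀ hyz (sum_finA_finA_comm a b x y z w hmu (le_refl N)),
    mul_comm (Ring.inverse (shiftedPow y _ _ * _))]

/-- The gauge factor of the intermediate partition is passed from one operator to the other, so it
need not be inverted. -/
theorem incAhat_mul_gauge {a b : ℤ → R} {x y z w : R} (h : Admissible a x y)
    (h' : Admissible a z w) {mu nu : YoungDiagram} (hle : mu ≤ nu) :
    (incAhat a b x y * incAhat a b z w) mu nu * gauge a b (extent nu) mu =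
      (incA b a x y * incA b a z w) mu nu * gauge a b (extent nu) nu := by
  rw [mul_apply_eq_sum_box (le_refl (extent nu)), mul_apply_eq_sum_box (le_refl (extent nu)), Finset.sum_mul,
    Finset.sum_mul]
  refine Finset.sum_congr rfl fun kap hkap => ?_
  rw [mem_box] at hkap
  have h1 := opAhat_mul_gauge (b := b) h hkap (extent_mono hle)
  have h2 := opAhat_mul_gauge (b := b) h' (le_refl (extent nu)) hkap
  simp only [incA_apply, incAhat_apply]
  linear_combination opAhat a b z w nu kap * h1 + opA b a x y mu kap * h2

theorem commute_incAhat [NoZeroDivisors R] {a b : ℤ → R} {x y z w : R} (h : Admissible a x y)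
    (h' : Admissible a z w) (hab : ∀ k, IsUnit (1 - a k * b k)) (hyz : y + z ≠ 0) :
    Commute (incAhat a b x y) (incAhat a b z w) := by
  refine IncidenceAlgebra.ext fun mu nu hle => ?_
  refine (isUnit_gauge hab (extent nu) mu).mul_left_injective ?_
  simp only
  rw [incAhat_mul_gauge h h' hle, incAhat_mul_gauge h' h hle, (commute_incA h h' hyz).eq]

/-! ### Rows with vanishing weights -/

theorem rowProd_split_column {M : ℤ → Matrix (Fin 2) (Fin 2) R} {k : ℤ} {p q : ℕ} {l r : Fin 2}
    (h : rowProd M k (p + (q + 1)) l r ≠ 0) :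
    ∃ i j, rowProd M k p l i ≠ 0 ∧ M (k + p) i j ≠ 0 ∧ rowProd M (k + p + 1) q j r ≠ 0 := by
  rw [rowProd_add, Matrix.mul_apply] at h
  obtain ⟨i, -, hi⟩ := Finset.exists_ne_zero_of_sum_ne_zero h
  have h2 := right_ne_zero_of_mul hi
  rw [rowProd, Matrix.mul_apply] at h2
  obtain ⟨j, -, hj⟩ := Finset.exists_ne_zero_of_sum_ne_zero h2
  exact ⟨i, j, left_ne_zero_of_mul hi, left_ne_zero_of_mul hj, right_ne_zero_of_mul hj⟩

/-- At `x = a_l` the weight `x - a_l` of a path running straight through the empty column `l` is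
zero. No path gets past this column, and `μ` has no particles beyond it. -/
theorem rowLen_le_of_opA_ne_zero {a b : ℤ → R} {y : R} {l : ℕ} {mu lam : YoungDiagram}
    (h : opA a b (a l) y mu lam ≠ 0) (hmu : mu.rowLen 0 < l) : lam.rowLen 0 ≤ l := by
  by_contra hlt
  push Not at hlt
  have hc : lam.rowLen 0 ≤ cutoff mu lam := by simp [cutoff]
  have h0 := left_ne_zero_of_mul h
  -- The window starts at `-cutoff + 1`, so `p` columns precede column `l` and `q` columns follow
  -- it.
  obtain ⟨p, hp⟩ : ∃ p : ℕ, (p : ℤ) = cutoff mu lam + l - 1 := ⟨cutoff mu lam + l - 1, by omega⟩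
  obtain ⟨q, hq⟩ : ∃ q : ℕ, (q : ℤ) = cutoff mu lam - l := ⟨cutoff mu lam - l, by omega⟩
  rw [finA, show cutoff mu lam + cutoff mu lam = p + (q + 1) by omega] at h0
  obtain ⟨i, j, -, h2, h3⟩ := rowProd_split_column h0
  rw [show -(cutoff mu lam : ℤ) + 1 + p = l by omega] at h2 h3
  have hj : j = 0 := by
    rw [occ_right (by exact_mod_cast hmu)] at h2
    revert h2
    cases occ lam l <;> fin_cases i <;> fin_cases j <;> simp [vertex]
  have h4 := rowProd_conserve _ (occ mu) (occ lam)
    (fun k l r => vertex_conserve _ _ _ _ _ _ l r) _ _ _ _ h3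
  rw [hj, cnt_eq_zero fun t ht _ => occ_right (by omega)] at h4
  have h5 := cnt_pos (k := l + 1) (N := q) (by omega) (by omega) (occ_rowLen lam)
  simp at h4
  omega

/-- At `y = a'_l = -a_{1-l}` the weight `y + a_{1-l}` is zero, so no path enters the column `1 - l`,
whose top edge is occupied, from the left. The particles further left then have to stay, and leave
no hole. -/
theorem colLen_le_of_opA_ne_zero {a b : ℤ → R} {x : R} {l : ℕ} {mu lam : YoungDiagram}
    (h : opA a b x (dualSeq a l) mu lam ≠ 0) (hmu : mu.colLen 0 < l) : lam.colLen 0 ≤ l := by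
  by_contra hlt
  push Not at hlt
  have hc : lam.colLen 0 ≤ cutoff mu lam := by simp [cutoff]
  have h0 := left_ne_zero_of_mul h
  obtain ⟨p, hp⟩ : ∃ p : ℕ, (p : ℤ) = cutoff mu lam - l := ⟨cutoff mu lam - l, by omega⟩
  obtain ⟨q, hq⟩ : ∃ q : ℕ, (q : ℤ) = cutoff mu lam + l - 1 := ⟨cutoff mu lam + l - 1, by omega⟩
  rw [finA, show cutoff mu lam + cutoff mu lam = p + (q + 1) by omega] at h0
  obtain ⟨i, j, h1, h2, -⟩ := rowProd_split_column h0
  rw [show -(cutoff mu lam : ℤ) + 1 + p = -(l : ℤ) + 1 by omega] at h2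
  have hi : i = 0 := by
    rw [occ_left (by omega)] at h2
    revert h2
    cases occ lam (-(l : ℤ) + 1) <;> fin_cases i <;> fin_cases j <;> simp [vertex, dualSeq]
  have h4 := rowProd_conserve _ (occ mu) (occ lam)
    (fun k l r => vertex_conserve _ _ _ _ _ _ l r) _ _ _ _ h1
  rw [hi, cnt_eq_self fun t _ ht => occ_left (by omega)] at h4
  have h5 := cnt_lt_self (k := -(cutoff mu lam : ℤ) + 1) (N := p) (by omega) (by omega)
    (occ_colLen lam)
  simp at h4
  omega

theorem opA_ne_zero_of_opAhat_ne_zero {a b : ℤ → R} {x y : R} (h : Admissible a x y)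
    (hab : ∀ k, IsUnit (1 - a k * b k)) {lam mu : YoungDiagram}
    (hne : opAhat a b x y lam mu ≠ 0) : opA b a x y mu lam ≠ 0 := by
  intro h0
  have h1 := opAhat_mul_gauge (b := b) h (le_max_left (extent lam) (extent mu))
    (le_max_right (extent lam) (extent mu))
  rw [h0, zero_mul] at h1
  exact hne ((isUnit_gauge hab _ mu).mul_left_eq_zero.1 h1)

/-- The operator `P` creates nothing beyond `l`, as measured by `f`. -/
def BoundedBy (f : YoungDiagram → ℕ) (P : IncidenceAlgebra R YoungDiagram) (l : ℕ) : Prop :=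
  ∀ mu lam, P mu lam ≠ 0 → f mu < l → f lam ≤ l

/-- With increasing barriers, the bound reached after one factor is still strictly below the next
barrier. -/
theorem le_of_list_prod_ne_zero_of_pairwise {ι : Type*} {f : YoungDiagram → ℕ}
    {P : ι → IncidenceAlgebra R YoungDiagram} {l : ι → ℕ} (hP : ∀ i, BoundedBy f (P i) (l i))
    {B : ℕ} {L : List ι} (hL : L.Pairwise fun i j => l i < l j) (hB : ∀ i ∈ L, l i ≤ B)
    {mu lam : YoungDiagram} (hmu : f mu ≤ B) (hmuL : ∀ i ∈ L, f mu < l i)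
    (h : (L.map P).prod mu lam ≠ 0) : f lam ≤ B := by
  induction L generalizing mu with
  | nil =>
    rw [List.map_nil, List.prod_nil, IncidenceAlgebra.one_apply] at h
    have : mu = lam := by
      by_contra hne
      exact h (if_neg hne)
    rwa [← this]
  | cons i L ih =>
    rw [List.map_cons, List.prod_cons, IncidenceAlgebra.mul_apply] at h
    obtain ⟨kap, -, hk⟩ := Finset.exists_ne_zero_of_sum_ne_zero h
    rw [List.pairwise_cons] at hL
    have h1 := hP i mu kap (left_ne_zero_of_mul hk) (hmuL i List.mem_cons_self)
    exact ih hL.2 (fun j hj => hB j (List.mem_cons_of_mem _ hj))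
      (h1.trans (hB i List.mem_cons_self)) (fun j hj => h1.trans_lt (hL.1 j hj))
      (right_ne_zero_of_mul hk)

theorem le_of_list_prod_ne_zero {ι : Type*} {f : YoungDiagram → ℕ}
    {P : ι → IncidenceAlgebra R YoungDiagram} {l : ι → ℕ} (hl : Function.Injective l)
    (hP : ∀ i, BoundedBy f (P i) (l i)) (hcomm : ∀ i j, i ≠ j → Commute (P i) (P j))
    {B : ℕ} {L : List ι} (hL : L.Nodup) (hB : ∀ i ∈ L, l i ≤ B)
    {mu lam : YoungDiagram} (hmu : f mu ≤ B) (hmuL : ∀ i ∈ L, f mu < l i)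
    (h : (L.map P).prod mu lam ≠ 0) : f lam ≤ B := by
  classical
  -- The factors commute, so they can be put in the order of increasing barriers; these are distinct
  -- by injectivity of `l`.
  set L' := L.insertionSort fun i j => l i ≤ l j with hL'
  have hperm : L'.Perm L := List.perm_insertionSort _ L
  have hsort : L'.Pairwise fun i j => l i ≤ l j := by
    have : Std.Total fun i j : ι => l i ≤ l j := ⟨fun i j => le_total _ _⟩
    have : IsTrans ι fun i j => l i ≤ l j := ⟨fun i j k => le_trans⟩
    exact List.pairwise_insertionSort _ L
  have hlt : L'.Pairwise fun i j => l i < l j :=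
    (hsort.and (hperm.nodup_iff.2 hL)).imp fun h => lt_of_le_of_ne h.1 fun he => h.2 (hl he)
  have hprod : (L'.map P).prod = (L.map P).prod := by
    refine (hperm.map P).prod_eq' ?_
    rw [List.pairwise_map]
    exact (hperm.nodup_iff.2 hL).imp fun hne => hcomm _ _ hne
  rw [← hprod] at h
  exact le_of_list_prod_ne_zero_of_pairwise hP hlt (fun i hi => hB i (hperm.mem_iff.1 hi)) hmu
    (fun i hi => hmuL i (hperm.mem_iff.1 hi)) h

section bounds

variable {n : ℕ} {a b : ℤ → R} {x y : Fin n → R} {mu lam : YoungDiagram} {l : Fin n → ℕ}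
  {f : YoungDiagram → ℕ}

theorem le_of_schur_ne_zero_of_boundedBy [NoZeroDivisors R] (hA : ∀ i, Admissible b (x i) (y i))
    (hxy : ∀ i j, i ≠ j → y i + x j ≠ 0) (hl : Function.Injective l)
    (hP : ∀ i, BoundedBy f (incA a b (x i) (y i)) (l i)) (hmu : ∀ i, f mu < l i)
    (h : schur a b x y lam mu ≠ 0) : f lam ≤ max (f mu) (Finset.univ.sup l) := by
  rw [schur_eq] at h
  exact le_of_list_prod_ne_zero hl hP
    (fun i j hij => commute_incA (hA i) (hA j) (hxy i j hij)) (List.nodup_finRange n)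
    (fun i _ => (Finset.le_sup (f := l) (Finset.mem_univ i)).trans (le_max_right _ _))
    (le_max_left _ _) (fun i _ => hmu i) h

theorem le_of_dualSchur_ne_zero_of_boundedBy [NoZeroDivisors R] (hA : ∀ i, Admissible a (x i) (y i))
    (hab : ∀ k, IsUnit (1 - a k * b k))
    (hxy : ∀ i j, i ≠ j → y i + x j ≠ 0) (hl : Function.Injective l)
    (hP : ∀ i, BoundedBy f (incA b a (x i) (y i)) (l i)) (hmu : ∀ i, f mu < l i)
    (h : dualSchur a b x y lam mu ≠ 0) : f lam ≤ max (f mu) (Finset.univ.sup l) := by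
  rw [dualSchur_eq] at h
  exact le_of_list_prod_ne_zero hl
    (fun i mu lam h => hP i mu lam (opA_ne_zero_of_opAhat_ne_zero (hA i) hab h))
    (fun i j hij => commute_incAhat (hA i) (hA j) hab (hxy i j hij))
    (List.nodup_reverse.2 (List.nodup_finRange n))
    (fun i _ => (Finset.le_sup (f := l) (Finset.mem_univ i)).trans (le_max_right _ _))
    (le_max_left _ _) (fun i _ => hmu i) h

theorem boundedBy_rowLen (a b : ℤ → R) (y : R) (l : ℕ) :
    BoundedBy (fun lam => lam.rowLen 0) (incA a b (a l) y) l :=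
  fun _ _ h hmu => rowLen_le_of_opA_ne_zero h hmu

theorem boundedBy_colLen (a b : ℤ → R) (x : R) (l : ℕ) :
    BoundedBy (fun lam => lam.colLen 0) (incA a b x (dualSeq a l)) l :=
  fun _ _ h hmu => colLen_le_of_opA_ne_zero h hmu

end bounds

/-! ### Change of rings -/

section map

variable {R' : Type*} [CommRing R'] (f : R →+* R')

theorem map_ringInverse_of_isUnit {u : R} (hu : IsUnit u) :
    f (Ring.inverse u) = Ring.inverse (f u) := by
  refine (hu.map f).mul_left_injective ?_
  simp only
  rw [← map_mul, Ring.inverse_mul_cancel _ hu, Ring.inverse_mul_cancel _ (hu.map f), map_one]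

theorem map_rowProd (M : ℤ → Matrix (Fin 2) (Fin 2) R) (k : ℤ) (N : ℕ) (l r : Fin 2) :
    f (rowProd M k N l r) = rowProd (fun k => (M k).map f) k N l r := by
  induction N generalizing k l with
  | zero => simp [rowProd, Matrix.one_apply, apply_ite f]
  | succ N ih => simp [rowProd, Matrix.mul_apply, ih]

theorem map_shiftedPow (x : R) (a : ℤ → R) (k : ℕ) :
    f (shiftedPow x a k) = shiftedPow (f x) (fun i => f (a i)) k := by
  simp [shiftedPow]

theorem map_shiftedPow_dualSeq (x : R) (a : ℤ → R) (k : ℕ) :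
    f (shiftedPow x (dualSeq a) k) = shiftedPow (f x) (dualSeq fun i => f (a i)) k := by
  simp [shiftedPow, dualSeq]

theorem Admissible.isUnit {b : ℤ → R} {x y : R} (h : Admissible b x y) (n m : ℕ) :
    IsUnit (shiftedPow y (dualSeq b) n * shiftedPow x b m) :=
  (isUnit_shiftedPow_dual h.2 n).mul (isUnit_shiftedPow h.1 m)

theorem map_opA {a b : ℤ → R} {x y : R} (h : Admissible b x y) (mu lam : YoungDiagram) :
    f (opA a b x y mu lam) = opA (fun k => f (a k)) (fun k => f (b k)) (f x) (f y) mu lam := by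
  rw [opA, opA, normA, normA, map_mul, map_ringInverse_of_isUnit f (h.isUnit _ _), map_mul,
    map_shiftedPow_dualSeq, map_shiftedPow, finA, finA, map_rowProd]
  congr 3
  funext k
  ext i j
  cases occ mu k <;> cases occ lam k <;> fin_cases i <;> fin_cases j <;> simp [vertex]

theorem map_opAhat {a b : ℤ → R} {x y : R} (h : Admissible a x y) (lam mu : YoungDiagram) :
    f (opAhat a b x y lam mu) =
      opAhat (fun k => f (a k)) (fun k => f (b k)) (f x) (f y) lam mu := by
  rw [opAhat, opAhat, normAhat, normAhat, map_mul, map_ringInverse_of_isUnit f (h.isUnit _ _),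
    map_mul, map_shiftedPow_dualSeq, map_shiftedPow, finAhat, finAhat, map_rowProd]
  congr 3
  funext k
  ext i j
  cases occ lam k <;> cases occ mu k <;> fin_cases i <;> fin_cases j <;> simp [dualVertex]

theorem map_list_prod_apply {ι : Type*} {P : ι → IncidenceAlgebra R YoungDiagram}
    {P' : ι → IncidenceAlgebra R' YoungDiagram} (h : ∀ i mu lam, f (P i mu lam) = P' i mu lam)
    (L : List ι) (mu lam : YoungDiagram) :
    f ((L.map P).prod mu lam) = (L.map P').prod mu lam := by
  induction L generalizing mu with
  | nil => simp [apply_ite f]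
  | cons i L ih => simp [IncidenceAlgebra.mul_apply, h, ih]

theorem map_schur {n : ℕ} {a b : ℤ → R} {x y : Fin n → R} (h : ∀ i, Admissible b (x i) (y i))
    (lam mu : YoungDiagram) : f (schur a b x y lam mu) =
      schur (fun k => f (a k)) (fun k => f (b k)) (fun i => f (x i)) (fun i => f (y i)) lam mu := by
  rw [schur_eq, schur_eq]
  exact map_list_prod_apply f (fun i mu lam => map_opA f (h i) mu lam) _ _ _

theorem map_dualSchur {n : ℕ} {a b : ℤ → R} {x y : Fin n → R}
    (h : ∀ i, Admissible a (x i) (y i)) (lam mu : YoungDiagram) : f (dualSchur a b x y lam mu) =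
      dualSchur (fun k => f (a k)) (fun k => f (b k)) (fun i => f (x i)) (fun i => f (y i))
        lam mu := by
  rw [dualSchur_eq, dualSchur_eq]
  exact map_list_prod_apply f (fun i mu lam => map_opAhat f (h i) lam mu) _ _ _

theorem map_cauchyFactor {n m : ℕ} {x y : Fin n → R} {z w : Fin m → R}
    (hxz : ∀ i j, IsUnit (1 - x i * z j)) (hyw : ∀ i j, IsUnit (1 - y i * w j)) :
    f (cauchyFactor x y z w) =
      cauchyFactor (fun i => f (x i)) (fun i => f (y i)) (fun j => f (z j)) fun j => f (w j) := by
  simp [cauchyFactor, map_ringInverse_of_isUnit f (hxz _ _),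
    map_ringInverse_of_isUnit f (hyw _ _)]

end map

/-! ### The sum over `λ` is finite -/

section finite

variable [NoZeroDivisors R] {n m : ℕ} {a b : ℤ → R} {x y : Fin n → R} {z w : Fin m → R}
  {mu nu : YoungDiagram} {K : ℕ}

/-- It suffices that one of the two factors of the term vanishes for wide `λ`, so either alternative
is enough. -/
theorem exists_rowLen_le (hA : ∀ i, Admissible b (x i) (y i)) (hA' : ∀ j, Admissible a (z j) (w j))
    (hab : ∀ k, IsUnit (1 - a k * b k)) (hxy : ∀ i j, y i + x j ≠ 0) (hzw : ∀ i j, w i + z j ≠ 0)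
    (hmu : mu.rowLen 0 < K) (hnu : nu.rowLen 0 < K)
    (h : (∃ l : Fin n → ℕ, Function.Injective l ∧ ∀ i, K ≤ l i ∧ x i = a (l i)) ∨
      ∃ l : Fin m → ℕ, Function.Injective l ∧ ∀ j, K ≤ l j ∧ z j = b (l j)) :
    ∃ p : ℕ, ∀ lam, schur a b x y lam mu * dualSchur a b z w lam nu ≠ 0 → lam.rowLen 0 ≤ p := by
  rcases h with ⟨l, hl, h⟩ | ⟨l, hl, h⟩
  · exact ⟨_, fun lam hne => le_of_schur_ne_zero_of_boundedBy
      (f := fun lam : YoungDiagram => lam.rowLen 0) hA (fun i j _ => hxy i j) hl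
      (fun i => by rw [(h i).2]; exact boundedBy_rowLen a b (y i) (l i))
      (fun i => hmu.trans_le (h i).1) (left_ne_zero_of_mul hne)⟩
  · exact ⟨_, fun lam hne => le_of_dualSchur_ne_zero_of_boundedBy
      (f := fun lam : YoungDiagram => lam.rowLen 0) hA' hab (fun i j _ => hzw i j) hl
      (fun i => by rw [(h i).2]; exact boundedBy_rowLen b a (w i) (l i))
      (fun i => hnu.trans_le (h i).1) (right_ne_zero_of_mul hne)⟩

theorem exists_colLen_le (hA : ∀ i, Admissible b (x i) (y i)) (hA' : ∀ j, Admissible a (z j) (w j))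
    (hab : ∀ k, IsUnit (1 - a k * b k)) (hxy : ∀ i j, y i + x j ≠ 0) (hzw : ∀ i j, w i + z j ≠ 0)
    (hmu : mu.colLen 0 < K) (hnu : nu.colLen 0 < K)
    (h : (∃ l : Fin n → ℕ, Function.Injective l ∧ ∀ i, K ≤ l i ∧ y i = dualSeq a (l i)) ∨
      ∃ l : Fin m → ℕ, Function.Injective l ∧ ∀ j, K ≤ l j ∧ w j = dualSeq b (l j)) :
    ∃ p : ℕ, ∀ lam, schur a b x y lam mu * dualSchur a b z w lam nu ≠ 0 → lam.colLen 0 ≤ p := by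
  rcases h with ⟨l, hl, h⟩ | ⟨l, hl, h⟩
  · exact ⟨_, fun lam hne => le_of_schur_ne_zero_of_boundedBy
      (f := fun lam : YoungDiagram => lam.colLen 0) hA (fun i j _ => hxy i j) hl
      (fun i => by rw [(h i).2]; exact boundedBy_colLen a b (x i) (l i))
      (fun i => hmu.trans_le (h i).1) (left_ne_zero_of_mul hne)⟩
  · exact ⟨_, fun lam hne => le_of_dualSchur_ne_zero_of_boundedBy
      (f := fun lam : YoungDiagram => lam.colLen 0) hA' hab (fun i j _ => hzw i j) hl
      (fun i => by rw [(h i).2]; exact boundedBy_colLen b a (z i) (l i))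
      (fun i => hnu.trans_le (h i).1) (right_ne_zero_of_mul hne)⟩

end finite

/-! ### From power series to fields -/

theorem finsum_rho_eq {n m : ℕ} (a b : ℤ → R) (x y : Fin n → R) (z w : Fin m → R)
    (mu nu : YoungDiagram) :
    ∑ᶠ rho, dualSchur a b z w mu rho * schur a b x y nu rho =
      ∑ rho ∈ Finset.Icc ⊥ nu, dualSchur a b z w mu rho * schur a b x y nu rho := by
  refine finsum_eq_sum_of_support_subset _ fun rho h => ?_
  rw [Finset.coe_Icc]
  exact ⟨bot_le, le_of_schur_ne_zero (right_ne_zero_of_mul h)⟩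

section transfer

open MvPolynomial (coeToMvPowerSeries.ringHom)

variable {σ F : Type*} [Field F] {n m : ℕ} {a b : ℤ → MvPolynomial σ ℤ}
  {x y : Fin n → MvPolynomial σ ℤ} {z w : Fin m → MvPolynomial σ ℤ}

/-- A specialization of the skew Cauchy identity that has finitely many terms holds for all values
of the indeterminates with nonzero denominators. -/
theorem finsum_schur_mul_dualSchur_of_polynomial (φ : MvPolynomial σ ℤ →+* F)
    (ha : ∀ k, (a k).constantCoeff = 0) (hb : ∀ k, (b k).constantCoeff = 0)
    (hx : ∀ i, (x i).constantCoeff = 0) (hy : ∀ i, (y i).constantCoeff = 0)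
    (hz : ∀ j, (z j).constantCoeff = 0) (hw : ∀ j, (w j).constantCoeff = 0)
    (hbx : ∀ i, ∀ k : ℤ, 1 ≤ k → φ (1 - b k * x i) ≠ 0)
    (hby : ∀ i, ∀ k : ℤ, k ≤ 0 → φ (1 + b k * y i) ≠ 0)
    (haz : ∀ j, ∀ k : ℤ, 1 ≤ k → φ (1 - a k * z j) ≠ 0)
    (haw : ∀ j, ∀ k : ℤ, k ≤ 0 → φ (1 + a k * w j) ≠ 0)
    (hxz : ∀ i j, φ (1 - x i * z j) ≠ 0) (hyw : ∀ i j, φ (1 - y i * w j) ≠ 0)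
    {mu nu : YoungDiagram} {B : Finset YoungDiagram}
    (hB : ∀ lam, schur (fun k => (a k : MvPowerSeries σ ℤ)) (fun k => (b k : MvPowerSeries σ ℤ))
        (fun i => (x i : MvPowerSeries σ ℤ)) (fun i => (y i : MvPowerSeries σ ℤ)) lam mu *
      dualSchur (fun k => (a k : MvPowerSeries σ ℤ)) (fun k => (b k : MvPowerSeries σ ℤ))
        (fun j => (z j : MvPowerSeries σ ℤ)) (fun j => (w j : MvPowerSeries σ ℤ)) lam nu ≠ 0 →
      lam ∈ B) :
    (Function.support fun lam => schur (fun k => φ (a k)) (fun k => φ (b k)) (fun i => φ (x i))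
        (fun i => φ (y i)) lam mu * dualSchur (fun k => φ (a k)) (fun k => φ (b k))
        (fun j => φ (z j)) (fun j => φ (w j)) lam nu).Finite ∧
      ∑ᶠ lam, schur (fun k => φ (a k)) (fun k => φ (b k)) (fun i => φ (x i))
          (fun i => φ (y i)) lam mu * dualSchur (fun k => φ (a k)) (fun k => φ (b k))
          (fun j => φ (z j)) (fun j => φ (w j)) lam nu =
        cauchyFactor (fun i => φ (x i)) (fun i => φ (y i)) (fun j => φ (z j)) (fun j => φ (w j)) *
          ∑ᶠ rho, dualSchur (fun k => φ (a k)) (fun k => φ (b k)) (fun j => φ (z j))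
            (fun j => φ (w j)) mu rho * schur (fun k => φ (a k)) (fun k => φ (b k))
            (fun i => φ (x i)) (fun i => φ (y i)) nu rho := by
  set ι : MvPolynomial σ ℤ →+* MvPowerSeries σ ℤ := coeToMvPowerSeries.ringHom with hι
  have hmem : ∀ {p : MvPolynomial σ ℤ}, p.constantCoeff = 0 → ι p ∈ augIdeal σ := by
    intro p hp
    rw [RingHom.mem_ker, ← hp, ← MvPowerSeries.coeff_zero_eq_constantCoeff_apply]
    exact MvPolynomial.coeff_coe p 0
  -- The polynomials that become invertible both in the field and in the power series ring; every
  -- denominator of the identity is among them.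
  set M : Submonoid (MvPolynomial σ ℤ) :=
    (IsUnit.submonoid F).comap φ ⊓ (IsUnit.submonoid (MvPowerSeries σ ℤ)).comap ι with hM
  set S := Localization M
  have hφ : ∀ s : M, IsUnit (φ s) := fun s => s.2.1
  have hιM : ∀ s : M, IsUnit (ι s) := fun s => s.2.2
  set f : S →+* F := IsLocalization.lift hφ with hf
  set g : S →+* MvPowerSeries σ ℤ := IsLocalization.lift hιM with hg
  set e : MvPolynomial σ ℤ →+* S := algebraMap _ S with he
  have hfe : ∀ p, f (e p) = φ p := fun p => IsLocalization.lift_eq hφ p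
  have hge : ∀ p, g (e p) = ι p := fun p => IsLocalization.lift_eq hιM p
  -- Polynomials embed into power series, hence so does the localization. Identities of power series
  -- can thus be pulled back to `S` and then sent to the field.
  have hinj : Function.Injective g := by
    refine (IsLocalization.lift_injective_iff hιM).2 fun p q => ⟨fun h => ?_, fun h => ?_⟩
    · rw [← hge, ← hge]
      exact congrArg g h
    · rw [MvPolynomial.coe_injective σ ℤ h]
  -- Constant term `1` makes `r` a unit of the power series ring; the other condition makes it a
  -- unit of the field.
  have hunit₀ : ∀ r : MvPolynomial σ ℤ, φ r ≠ 0 → (1 - r).constantCoeff = 0 → IsUnit (e r) := by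
    intro r hr hr'
    refine IsLocalization.map_units S (⟨r, isUnit_iff_ne_zero.2 hr, ?_⟩ : M)
    show IsUnit (ι r)
    have := isUnit_one_sub_of_mem_augIdeal (hmem hr')
    rwa [map_sub, map_one, sub_sub_cancel] at this
  have hunit : ∀ {p q : MvPolynomial σ ℤ}, p.constantCoeff = 0 → φ (1 - p * q) ≠ 0 →
      IsUnit (1 - e p * e q) := by
    intro p q hp h
    simpa using hunit₀ (1 - p * q) h (by simp [hp])
  have hunit' : ∀ {p q : MvPolynomial σ ℤ}, p.constantCoeff = 0 → φ (1 + p * q) ≠ 0 →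
      IsUnit (1 + e p * e q) := by
    intro p q hp h
    simpa using hunit₀ (1 + p * q) h (by simp [hp])
  have hA : ∀ i, Admissible (fun k => e (b k)) (e (x i)) (e (y i)) := fun i =>
    ⟨fun k hk => hunit (hb k) (hbx i k hk), fun k hk => hunit' (hb k) (hby i k hk)⟩
  have hA' : ∀ j, Admissible (fun k => e (a k)) (e (z j)) (e (w j)) := fun j =>
    ⟨fun k hk => hunit (ha k) (haz j k hk), fun k hk => hunit' (ha k) (haw j k hk)⟩
  have hS : ∀ lam, g (schur (fun k => e (a k)) (fun k => e (b k)) (fun i => e (x i))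
        (fun i => e (y i)) lam mu * dualSchur (fun k => e (a k)) (fun k => e (b k))
        (fun j => e (z j)) (fun j => e (w j)) lam nu) =
      schur (fun k => ι (a k)) (fun k => ι (b k)) (fun i => ι (x i))
        (fun i => ι (y i)) lam mu * dualSchur (fun k => ι (a k)) (fun k => ι (b k))
        (fun j => ι (z j)) (fun j => ι (w j)) lam nu := by
    intro lam
    rw [map_mul, map_schur g hA, map_dualSchur g hA']
    simp only [hge]
  have hF : ∀ lam, f (schur (fun k => e (a k)) (fun k => e (b k)) (fun i => e (x i))
        (fun i => e (y i)) lam mu * dualSchur (fun k => e (a k)) (fun k => e (b k))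
        (fun j => e (z j)) (fun j => e (w j)) lam nu) =
      schur (fun k => φ (a k)) (fun k => φ (b k)) (fun i => φ (x i))
        (fun i => φ (y i)) lam mu * dualSchur (fun k => φ (a k)) (fun k => φ (b k))
        (fun j => φ (z j)) (fun j => φ (w j)) lam nu := by
    intro lam
    rw [map_mul, map_schur f hA, map_dualSchur f hA']
    simp only [hfe]
  -- A term that is zero as a power series is zero in the localization, hence at every admissible
  -- point.
  have hsupp : (Function.support fun lam => schur (fun k => φ (a k)) (fun k => φ (b k))
        (fun i => φ (x i)) (fun i => φ (y i)) lam mu * dualSchur (fun k => φ (a k))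
        (fun k => φ (b k)) (fun j => φ (z j)) (fun j => φ (w j)) lam nu) ⊆ ↑B := by
    intro lam hne
    refine hB lam fun h0 => hne ?_
    simp only
    rw [← hF, hinj (((hS lam).trans h0).trans (map_zero g).symm), map_zero]
  refine ⟨B.finite_toSet.subset hsupp, ?_⟩
  have hsum := hasSum_schur_mul_dualSchur (fun k => hmem (ha k)) (fun k => hmem (hb k))
    (fun i => hmem (hx i)) (fun i => hmem (hy i)) (fun j => hmem (hz j)) (fun j => hmem (hw j))
    mu nu
  -- Only terms in `B` are nonzero, so the convergent series is a finite sum.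
  have hsum' := (hasSum_sum_of_ne_finset_zero fun lam hlam => by
    by_contra hne
    exact hlam (hB lam hne)).unique hsum
  have hxz' : ∀ i j, IsUnit (1 - e (x i) * e (z j)) := fun i j => hunit (hx i) (hxz i j)
  have hyw' : ∀ i j, IsUnit (1 - e (y i) * e (w j)) := fun i j => hunit (hy i) (hyw i j)
  have hmain : ∑ lam ∈ B, schur (fun k => e (a k)) (fun k => e (b k)) (fun i => e (x i))
        (fun i => e (y i)) lam mu * dualSchur (fun k => e (a k)) (fun k => e (b k))
        (fun j => e (z j)) (fun j => e (w j)) lam nu =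
      cauchyFactor (fun i => e (x i)) (fun i => e (y i)) (fun j => e (z j)) (fun j => e (w j)) *
        ∑ rho ∈ Finset.Icc ⊥ nu, dualSchur (fun k => e (a k)) (fun k => e (b k))
          (fun j => e (z j)) (fun j => e (w j)) mu rho * schur (fun k => e (a k))
          (fun k => e (b k)) (fun i => e (x i)) (fun i => e (y i)) nu rho := by
    refine hinj ?_
    rw [map_sum, Finset.sum_congr rfl fun lam _ => hS lam, map_mul,
      map_cauchyFactor g hxz' hyw', map_sum]
    simp only [map_mul, map_schur g hA, map_dualSchur g hA', hge]
    rw [finsum_rho_eq] at hsum'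
    exact hsum'
  rw [finsum_eq_sum_of_support_subset _ hsupp, ← Finset.sum_congr rfl fun lam _ => hF lam,
    ← map_sum, hmain, map_mul, map_cauchyFactor f hxz' hyw', map_sum, finsum_rho_eq]
  simp only [map_mul, map_schur f hA, map_dualSchur f hA', hfe]

end transfer

/-! ### Lifting a point of the field to a generic specialization -/

/-- The indeterminates that are specialized in the identity of finite sums to `x` or `z`. -/
def Var.IsRight {n m : ℕ} : Var n m → Prop
  | .x _ | .z _ => True
  | .y _ | .w _ => False
  | .a k | .b k => 1 ≤ k

/-- The values of the indeterminates at a point. -/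
def Var.val {n m : ℕ} (x y : Fin n → R) (z w : Fin m → R) (a b : ℤ → R) : Var n m → R
  | .x i => x i
  | .y i => y i
  | .z j => z j
  | .w j => w j
  | .a k => a k
  | .b k => b k

/-- The two indeterminates are different, so they cannot cancel: the second one has coefficient `1`
in the sum. -/
theorem Var.add_ne_zero {n m : ℕ} {p q : MvPolynomial (Var n m) ℤ}
    (hp : ∃ t : Var n m, ¬t.IsRight ∧ (p = MvPolynomial.X t ∨ p = -MvPolynomial.X t))
    (hq : ∃ s : Var n m, s.IsRight ∧ q = MvPolynomial.X s) : p + q ≠ 0 := by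
  classical
  obtain ⟨t, ht, hp⟩ := hp
  obtain ⟨s, hs, rfl⟩ := hq
  have hts : t ≠ s := by
    rintro rfl
    exact ht hs
  intro h
  have h1 := congrArg (MvPolynomial.coeff (Finsupp.single s 1)) h
  rcases hp with rfl | rfl <;> simp [MvPolynomial.coeff_X, Finsupp.single_left_inj, hts] at h1

theorem coe_add_coe_ne_zero {σ : Type*} {p q : MvPolynomial σ ℤ} (h : p + q ≠ 0) :
    (p : MvPowerSeries σ ℤ) + (q : MvPowerSeries σ ℤ) ≠ 0 := by
  rw [← MvPolynomial.coe_add]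
  exact mt MvPolynomial.coe_eq_zero_iff.1 h

/-- Evaluation at a point. -/
def evalAt {n m : ℕ} (x y : Fin n → R) (z w : Fin m → R) (a b : ℤ → R) :
    MvPolynomial (Var n m) ℤ →+* R :=
  MvPolynomial.eval₂Hom (Int.castRingHom R) (Var.val x y z w a b)

theorem evalAt_X {n m : ℕ} (x y : Fin n → R) (z w : Fin m → R) (a b : ℤ → R) (v : Var n m) :
    evalAt x y z w a b (MvPolynomial.X v) = Var.val x y z w a b v :=
  MvPolynomial.eval₂Hom_X' _ _ v

/-- The values `x`, `z` are those of indeterminates on the right. -/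
theorem Var.exists_right {F : Type*} [Field F] {n m : ℕ} (x y : Fin n → F)
    (z w : Fin m → F) (a b : ℤ → F) (K : ℕ) (hK : 1 ≤ K)
    (h : (∃ l : Fin n → ℕ, Function.Injective l ∧ ∀ i, K ≤ l i ∧ x i = a (l i)) ∨
      ∃ l : Fin m → ℕ, Function.Injective l ∧ ∀ j, K ≤ l j ∧ z j = b (l j)) :
    ∃ (X : Fin n → MvPolynomial (Var n m) ℤ) (Z : Fin m → MvPolynomial (Var n m) ℤ),
    (∀ i, ∃ s : Var n m, s.IsRight ∧ X i = MvPolynomial.X s) ∧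
    (∀ j, ∃ s : Var n m, s.IsRight ∧ Z j = MvPolynomial.X s) ∧
    (∀ i, evalAt x y z w a b (X i) = x i) ∧ (∀ j, evalAt x y z w a b (Z j) = z j) ∧
    ((∃ l : Fin n → ℕ, Function.Injective l ∧ ∀ i, K ≤ l i ∧ X i = MvPolynomial.X (.a (l i))) ∨
      ∃ l : Fin m → ℕ, Function.Injective l ∧ ∀ j, K ≤ l j ∧ Z j = MvPolynomial.X (.b (l j))) := by
  rcases h with ⟨l, hl, h⟩ | ⟨l, hl, h⟩
  · refine ⟨fun i => MvPolynomial.X (.a (l i)), fun j => MvPolynomial.X (.z j),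
      fun i => ⟨.a (l i), ?_, rfl⟩, fun j => ⟨.z j, trivial, rfl⟩, fun i => ?_,
      fun j => evalAt_X _ _ _ _ _ _ _,
      Or.inl ⟨l, hl, fun i => ⟨(h i).1, rfl⟩⟩⟩
    · have := (h i).1
      show (1 : ℤ) ≤ l i
      omega
    · rw [evalAt_X, Var.val, (h i).2]
  · refine ⟨fun i => MvPolynomial.X (.x i), fun j => MvPolynomial.X (.b (l j)),
      fun i => ⟨.x i, trivial, rfl⟩, fun j => ⟨.b (l j), ?_, rfl⟩,
      fun i => evalAt_X _ _ _ _ _ _ _, fun j => ?_,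
      Or.inr ⟨l, hl, fun j => ⟨(h j).1, rfl⟩⟩⟩
    · have := (h j).1
      show (1 : ℤ) ≤ l j
      omega
    · rw [evalAt_X, Var.val, (h j).2]

/-- The values `y`, `w` are those of indeterminates on the left, up to sign. -/
theorem Var.exists_left {F : Type*} [Field F] {n m : ℕ} (x y : Fin n → F)
    (z w : Fin m → F) (a b : ℤ → F) (K : ℕ) (hK : 1 ≤ K)
    (h : (∃ l : Fin n → ℕ, Function.Injective l ∧ ∀ i, K ≤ l i ∧ y i = dualSeq a (l i)) ∨
      ∃ l : Fin m → ℕ, Function.Injective l ∧ ∀ j, K ≤ l j ∧ w j = dualSeq b (l j)) :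
    ∃ (Y : Fin n → MvPolynomial (Var n m) ℤ) (W : Fin m → MvPolynomial (Var n m) ℤ),
    (∀ i, ∃ s : Var n m, ¬s.IsRight ∧ (Y i = MvPolynomial.X s ∨ Y i = -MvPolynomial.X s)) ∧
    (∀ j, ∃ s : Var n m, ¬s.IsRight ∧ (W j = MvPolynomial.X s ∨ W j = -MvPolynomial.X s)) ∧
    (∀ i, evalAt x y z w a b (Y i) = y i) ∧ (∀ j, evalAt x y z w a b (W j) = w j) ∧
    ((∃ l : Fin n → ℕ, Function.Injective l ∧ ∀ i, K ≤ l i ∧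
        Y i = dualSeq (fun k => MvPolynomial.X (.a k)) (l i)) ∨
      ∃ l : Fin m → ℕ, Function.Injective l ∧ ∀ j, K ≤ l j ∧
        W j = dualSeq (fun k => MvPolynomial.X (.b k)) (l j)) := by
  rcases h with ⟨l, hl, h⟩ | ⟨l, hl, h⟩
  · refine ⟨fun i => -MvPolynomial.X (.a (-(l i : ℤ) + 1)), fun j => MvPolynomial.X (.w j),
      fun i => ⟨.a (-(l i : ℤ) + 1), ?_, Or.inr rfl⟩, fun j => ⟨.w j, id, Or.inl rfl⟩, fun i => ?_,
      fun j => evalAt_X _ _ _ _ _ _ _,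
      Or.inl ⟨l, hl, fun i => ⟨(h i).1, rfl⟩⟩⟩
    · have := (h i).1
      show ¬(1 : ℤ) ≤ -(l i : ℤ) + 1
      omega
    · rw [map_neg, evalAt_X, Var.val, (h i).2, dualSeq]
  · refine ⟨fun i => MvPolynomial.X (.y i), fun j => -MvPolynomial.X (.b (-(l j : ℤ) + 1)),
      fun i => ⟨.y i, id, Or.inl rfl⟩, fun j => ⟨.b (-(l j : ℤ) + 1), ?_, Or.inr rfl⟩,
      fun i => evalAt_X _ _ _ _ _ _ _, fun j => ?_,
      Or.inr ⟨l, hl, fun j => ⟨(h j).1, rfl⟩⟩⟩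
    · have := (h j).1
      show ¬(1 : ℤ) ≤ -(l j : ℤ) + 1
      omega
    · rw [map_neg, evalAt_X, Var.val, (h j).2, dualSeq]

/-- At the given point `y_i + x_j` or `1 - a_k b_k` may vanish, and the bounds on `λ` are not
available. They are proved for the lift, where only the required coincidences with `a_l`, `b_l`,
`a'_l`, `b'_l` are imposed and all else stays indeterminate. -/
theorem finsum_schur_mul_dualSchur {F : Type*} [Field F] {n m : ℕ} {x y : Fin n → F}
    {z w : Fin m → F} {a b : ℤ → F} {mu nu : YoungDiagram} {K : ℕ} (hmu : extent mu < K)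
    (hnu : extent nu < K)
    (hbx : ∀ i, ∀ k : ℤ, 1 ≤ k → 1 - b k * x i ≠ 0)
    (hby : ∀ i, ∀ k : ℤ, k ≤ 0 → 1 + b k * y i ≠ 0)
    (haz : ∀ j, ∀ k : ℤ, 1 ≤ k → 1 - a k * z j ≠ 0)
    (haw : ∀ j, ∀ k : ℤ, k ≤ 0 → 1 + a k * w j ≠ 0)
    (hxz : ∀ i j, 1 - x i * z j ≠ 0) (hyw : ∀ i j, 1 - y i * w j ≠ 0)
    (h1 : (∃ l : Fin n → ℕ, Function.Injective l ∧ ∀ i, K ≤ l i ∧ x i = a (l i)) ∨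
      ∃ l : Fin m → ℕ, Function.Injective l ∧ ∀ j, K ≤ l j ∧ z j = b (l j))
    (h2 : (∃ l : Fin n → ℕ, Function.Injective l ∧ ∀ i, K ≤ l i ∧ y i = dualSeq a (l i)) ∨
      ∃ l : Fin m → ℕ, Function.Injective l ∧ ∀ j, K ≤ l j ∧ w j = dualSeq b (l j)) :
    (Function.support fun lam => schur a b x y lam mu * dualSchur a b z w lam nu).Finite ∧
      ∑ᶠ lam, schur a b x y lam mu * dualSchur a b z w lam nu =
        cauchyFactor x y z w * ∑ᶠ rho, dualSchur a b z w mu rho * schur a b x y nu rho := by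
  obtain ⟨X, Z, hXr, hZr, hφX, hφZ, h1'⟩ := Var.exists_right x y z w a b K (by omega) h1
  obtain ⟨Y, W, hYr, hWr, hφY, hφW, h2'⟩ := Var.exists_left x y z w a b K (by omega) h2
  set φ := evalAt x y z w a b
  set A : ℤ → MvPolynomial (Var n m) ℤ := fun k => MvPolynomial.X (.a k) with hA
  set B : ℤ → MvPolynomial (Var n m) ℤ := fun k => MvPolynomial.X (.b k) with hB
  have hAφ : ∀ k, φ (A k) = a k := fun k => evalAt_X _ _ _ _ _ _ _
  have hBφ : ∀ k, φ (B k) = b k := fun k => evalAt_X _ _ _ _ _ _ _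
  have cA : ∀ k, (A k).constantCoeff = 0 := fun k => by simp [hA]
  have cB : ∀ k, (B k).constantCoeff = 0 := fun k => by simp [hB]
  have cX : ∀ i, (X i).constantCoeff = 0 := fun i => by
    obtain ⟨s, -, h⟩ := hXr i
    simp [h]
  have cZ : ∀ i, (Z i).constantCoeff = 0 := fun i => by
    obtain ⟨s, -, h⟩ := hZr i
    simp [h]
  have cY : ∀ i, (Y i).constantCoeff = 0 := fun i => by
    obtain ⟨s, -, h | h⟩ := hYr i <;> simp [h]
  have cW : ∀ i, (W i).constantCoeff = 0 := fun i => by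
    obtain ⟨s, -, h | h⟩ := hWr i <;> simp [h]
  have mA : ∀ k, (A k : MvPowerSeries (Var n m) ℤ) ∈ augIdeal (Var n m) := fun k => by
    rw [RingHom.mem_ker, hA, MvPolynomial.coe_X, MvPowerSeries.constantCoeff_X]
  have mB : ∀ k, (B k : MvPowerSeries (Var n m) ℤ) ∈ augIdeal (Var n m) := fun k => by
    rw [RingHom.mem_ker, hB, MvPolynomial.coe_X, MvPowerSeries.constantCoeff_X]
  have hunit : ∀ p ∈ augIdeal (Var n m), IsUnit (1 - p) := fun _ =>
    isUnit_one_sub_of_mem_augIdeal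
  have hAB : ∀ k, IsUnit (1 - (A k : MvPowerSeries (Var n m) ℤ) * (B k)) := fun k =>
    hunit _ (Ideal.mul_mem_right _ _ (mA k))
  have hYX : ∀ i j, (Y i : MvPowerSeries (Var n m) ℤ) + (X j) ≠ 0 := fun i j =>
    coe_add_coe_ne_zero (Var.add_ne_zero (hYr i) (hXr j))
  have hWZ : ∀ i j, (W i : MvPowerSeries (Var n m) ℤ) + (Z j) ≠ 0 := fun i j =>
    coe_add_coe_ne_zero (Var.add_ne_zero (hWr i) (hZr j))
  have hdual : ∀ (C : ℤ → MvPolynomial (Var n m) ℤ) (k : ℤ),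
      ((dualSeq C k : MvPolynomial (Var n m) ℤ) : MvPowerSeries (Var n m) ℤ) =
        dualSeq (fun k => (C k : MvPowerSeries (Var n m) ℤ)) k := fun C k =>
    map_neg (MvPolynomial.coeToMvPowerSeries.ringHom (σ := Var n m) (R := ℤ)) _
  -- One condition bounds the rows of `λ` and the other one the columns, which leaves the finitely
  -- many diagrams in a rectangle.
  obtain ⟨p, hp⟩ := exists_rowLen_le (R := MvPowerSeries (Var n m) ℤ) (mu := mu) (nu := nu) (K := K)
    (a := fun k => (A k : MvPowerSeries (Var n m) ℤ)) (b := fun k => B k)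
    (x := fun i => X i) (y := fun i => Y i) (z := fun j => Z j) (w := fun j => W j)
    (fun i => admissible_of_mem hunit mB _ _) (fun j => admissible_of_mem hunit mA _ _) hAB hYX hWZ
    ((le_max_left _ _).trans_lt hmu) ((le_max_left _ _).trans_lt hnu)
    (h1'.imp (fun ⟨l, hl, h⟩ => ⟨l, hl, fun i => ⟨(h i).1, by rw [(h i).2]⟩⟩)
      (fun ⟨l, hl, h⟩ => ⟨l, hl, fun i => ⟨(h i).1, by rw [(h i).2]⟩⟩))
  obtain ⟨q, hq⟩ := exists_colLen_le (R := MvPowerSeries (Var n m) ℤ) (mu := mu) (nu := nu) (K := K)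
    (a := fun k => (A k : MvPowerSeries (Var n m) ℤ)) (b := fun k => B k)
    (x := fun i => X i) (y := fun i => Y i) (z := fun j => Z j) (w := fun j => W j)
    (fun i => admissible_of_mem hunit mB _ _) (fun j => admissible_of_mem hunit mA _ _) hAB hYX hWZ
    ((le_max_right _ _).trans_lt hmu) ((le_max_right _ _).trans_lt hnu)
    (h2'.imp (fun ⟨l, hl, h⟩ => ⟨l, hl, fun i => ⟨(h i).1, by rw [(h i).2, hdual]⟩⟩)
      (fun ⟨l, hl, h⟩ => ⟨l, hl, fun i => ⟨(h i).1, by rw [(h i).2, hdual]⟩⟩))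
  have := finsum_schur_mul_dualSchur_of_polynomial φ cA cB cX cY cZ cW
    (by simpa [hAφ, hBφ, hφX, hφY, hφZ, hφW] using hbx)
    (by simpa [hAφ, hBφ, hφX, hφY, hφZ, hφW] using hby)
    (by simpa [hAφ, hBφ, hφX, hφY, hφZ, hφW] using haz)
    (by simpa [hAφ, hBφ, hφX, hφY, hφZ, hφW] using haw)
    (by simpa [hAφ, hBφ, hφX, hφY, hφZ, hφW] using hxz)
    (by simpa [hAφ, hBφ, hφX, hφY, hφZ, hφW] using hyw)
    (B := (finite_bounded p q).toFinset) (mu := mu) (nu := nu)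
    (fun lam hne => (Set.Finite.mem_toFinset _).2 ⟨hp lam hne, hq lam hne⟩)
  simpa only [hAφ, hBφ, hφX, hφY, hφZ, hφW] using this

end FreeFermionic

end

/-! ### The skew Cauchy identity in both senses -/

theorem mainTheorem2 (mu nu : YoungDiagram) :
    -- the identity of formal power series, all variables and parameters being indeterminates
    (∀ n m : ℕ,
      HasSum (fun lam : YoungDiagram =>
          FreeFermionic.schur (FreeFermionic.PS.a n m) (FreeFermionic.PS.b n m)
              (FreeFermionic.PS.x n m) (FreeFermionic.PS.y n m) lam mu *
            FreeFermionic.dualSchur (FreeFermionic.PS.a n m) (FreeFermionic.PS.b n m)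
              (FreeFermionic.PS.z n m) (FreeFermionic.PS.w n m) lam nu)
        (FreeFermionic.cauchyFactor (FreeFermionic.PS.x n m) (FreeFermionic.PS.y n m)
            (FreeFermionic.PS.z n m) (FreeFermionic.PS.w n m) *
          ∑ᶠ rho : YoungDiagram,
            FreeFermionic.dualSchur (FreeFermionic.PS.a n m) (FreeFermionic.PS.b n m)
                (FreeFermionic.PS.z n m) (FreeFermionic.PS.w n m) mu rho *
              FreeFermionic.schur (FreeFermionic.PS.a n m) (FreeFermionic.PS.b n m)
                (FreeFermionic.PS.x n m) (FreeFermionic.PS.y n m) nu rho)) ∧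
    -- the identity of finite sums, for variables and parameters in a field that satisfy
    -- vanishing conditions far out on both sides
    (∃ K : ℕ, ∀ (F : Type*) [Field F] (n m : ℕ) (x y : Fin n → F) (z w : Fin m → F)
        (a b : ℤ → F),
      (∀ i, ∀ k : ℤ, 1 ≤ k → 1 - b k * x i ≠ 0) →
      (∀ i, ∀ k : ℤ, k ≤ 0 → 1 + b k * y i ≠ 0) →
      (∀ j, ∀ k : ℤ, 1 ≤ k → 1 - a k * z j ≠ 0) →
      (∀ j, ∀ k : ℤ, k ≤ 0 → 1 + a k * w j ≠ 0) →
      (∀ i j, 1 - x i * z j ≠ 0) →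
      (∀ i j, 1 - y i * w j ≠ 0) →
      ((∃ l : Fin n → ℕ, Function.Injective l ∧ ∀ i, K ≤ l i ∧ x i = a (l i)) ∨
        (∃ l : Fin m → ℕ, Function.Injective l ∧ ∀ j, K ≤ l j ∧ z j = b (l j))) →
      ((∃ k : Fin n → ℕ, Function.Injective k ∧
          ∀ i, K ≤ k i ∧ y i = FreeFermionic.dualSeq a (k i)) ∨
        (∃ k : Fin m → ℕ, Function.Injective k ∧
          ∀ j, K ≤ k j ∧ w j = FreeFermionic.dualSeq b (k j))) →
      (Function.support fun lam : YoungDiagram =>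
          FreeFermionic.schur a b x y lam mu * FreeFermionic.dualSchur a b z w lam nu).Finite ∧
        ∑ᶠ lam : YoungDiagram,
            FreeFermionic.schur a b x y lam mu * FreeFermionic.dualSchur a b z w lam nu =
          FreeFermionic.cauchyFactor x y z w *
            ∑ᶠ rho : YoungDiagram,
              FreeFermionic.dualSchur a b z w mu rho * FreeFermionic.schur a b x y nu rho) := by
  -- This `K` puts all barriers strictly beyond `μ` and `ν`. Being at least `1`, it also separates
  -- the indices `l ≥ 1` used for `x`, `z` from the indices `1 - l ≤ 0` used for `y`, `w`.
  refine ⟨fun n m => ?_, max (FreeFermionic.extent mu) (FreeFermionic.extent nu) + 1, ?_⟩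
  · have hX : ∀ v : FreeFermionic.Var n m,
        MvPowerSeries.X v ∈ FreeFermionic.augIdeal (FreeFermionic.Var n m) := fun v =>
      RingHom.mem_ker.2 (MvPowerSeries.constantCoeff_X v)
    exact FreeFermionic.hasSum_schur_mul_dualSchur (fun _ => hX _) (fun _ => hX _) (fun _ => hX _)
      (fun _ => hX _) (fun _ => hX _) (fun _ => hX _) mu nu
  · intro F _ n m x y z w a b hbx hby haz haw hxz hyw h1 h2
    exact FreeFermionic.finsum_schur_mul_dualSchur (Nat.lt_succ_of_le (le_max_left _ _))
      (Nat.lt_succ_of_le (le_max_right _ _)) hbx hby haz haw hxz hyw h1 h2
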